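/- Let $d\ge 1$ be an integer, let $N_d+1=\binom{d+3}{3}$ be the number of monomials of degree $d$ in $Z_0,\dots,Z_3$, and let $U\subset\mathbb P^{N_d+1}$ be the open set of points $[a_d:(a_\alpha)_{|\alpha|=d}]$ with $a_d\neq 0$ and some $a_\alpha\neq 0$; we normalise $a_d=1$. Let $$\mathcal Y=\Big\{Z_4^d+\sum_{|\alpha|=d}a_\alpha Z_0^{\alpha_0}Z_1^{\alpha_1}Z_2^{\alpha_2}Z_3^{\alpha_3}=0\Big\}\subset\mathbb P^4\times U,\qquad H=\{Z_4=0\}\subset\mathcal Y .$$ Let $p:\overline{J_3^v}(\mathcal Y)\to\mathcal Y$ be the space of logarithmic 3-jets of $(\mathcal Y,H)$ tangent to the fibres of $\mathcal Y\to U$, that is, the logarithmic 3-jets of $(\mathbb P^4\times U,\{Z_4=0\})$ with constant parameter along which the equation of $\mathcal Y$ vanishes to order $3$. In the chart $\{Z_0\ne0\}$ with $z_i=Z_i/Z_0$, let $(z_i,a_\alpha,\xi_i^{(j)})_{1\le i\le 4,\,1\le j\le 3}$ be the coordinates on logarithmic 3-jets given by the forms $dz_1,dz_2,dz_3,dz_4/z_4$,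 let $$\Sigma_0=\{\det(\xi_i^{(j)})_{1\le i,j\le 3}=0\}\subset\overline{J_3^v}(\mathcal Y)|_{Z_0\ne0},$$ and let $\Sigma$ be the closure of $\Sigma_0$ in $\overline{J_3^v}(\mathcal Y)$. Then the sheaf $T_{\overline{J_3^v}(\mathcal Y)}\otimes\mathcal O_{\mathbb P^4}(12)\otimes\mathcal O_{\mathbb P^{N_d+1}}(*)$, where $(*)$ means that the sections may have poles of arbitrary finite order along the hyperplane $a_d=0$ of the parameter space, is generated by its global sections on $\overline{J_3^v}(\mathcal Y)\setminus(\Sigma\cup p^{-1}(H))$: at every point of this set the values of the global algebraic sections (those defined on all of $\overline{J_3^v}(\mathcal Y)$) span the fibre. -/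

import Mathlib

open PowerSeries

namespace LogJet

/-- The multi-indices `α = (α₀, α₁, α₂, α₃)` of length `|α| = d`. -/
abbrev MultiIndex (d : ℕ) : Type :=
  {α : Fin 4 → Fin (d + 1) // ∑ m, (α m : ℕ) = d}

/-- Index set of the coordinates on the vertical logarithmic 3-jets of the ambient log manifold
`(ℙ⁴ × U, {Z₄ = 0})` over one chart `{Zᵢ ≠ 0}`, `0 ≤ i ≤ 3`.

* `Sum.inl α` is the parameter `a_α` (homogeneous coordinates on the parameter space are
  normalised so that the coefficient of `Z₄ ^ d` is `1`);
* `Sum.inr (Sum.inl (m, k))`: order `k` data of the `m`-th of the three functions `Z_l / Z_i`,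
  `l ∈ {0,1,2,3} \ {i}` taken in increasing order: the coordinate `z_m` itself if `k = 0`, and
  `ξ_m^{(k)}`, given by the form `dz_m`, if `k = 1, 2, 3`;
* `Sum.inr (Sum.inr k)`: the same for `z₄ = Z₄ / Z_i`: the coordinate `z₄` if `k = 0`, and
  `ξ₄^{(k)}`, given by the logarithmic form `dz₄ / z₄`, if `k = 1, 2, 3`. -/
abbrev Coord (d : ℕ) : Type :=
  MultiIndex d ⊕ (Fin 3 × Fin 4) ⊕ Fin 4

/-- The coordinate space of one chart. -/
abbrev Ambient (d : ℕ) : Type := Coord d → ℂ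

/-- The parameter `a_α`. -/
def param {d : ℕ} (q : Ambient d) (α : MultiIndex d) : ℂ := q (Sum.inl α)

/-- `ξ_m^{(k)}`, and `z_m` for `k = 0`. -/
def xi {d : ℕ} (q : Ambient d) (m : Fin 3) (k : Fin 4) : ℂ := q (Sum.inr (Sum.inl (m, k)))

/-- `ξ₄^{(k)}` (logarithmic), and `z₄` for `k = 0`. -/
def xi4 {d : ℕ} (q : Ambient d) (k : Fin 4) : ℂ := q (Sum.inr (Sum.inr k))

/-- Taylor expansion, modulo `t ^ 4`, of the functions `Z₀/Z_i, …, Z₃/Z_i` along the jet `q` of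
the chart `{Z_i ≠ 0}`. -/
noncomputable def base {d : ℕ} (i : Fin 4) (q : Ambient d) : Fin 4 → ℂ⟦X⟧ :=
  Fin.insertNth (α := fun _ => ℂ⟦X⟧) i 1 fun m =>
    C (xi q m 0) + C (xi q m 1) * X + C (xi q m 2 / 2) * X ^ 2 + C (xi q m 3 / 6) * X ^ 3

/-- Taylor expansion, modulo `t ^ 4`, of `Z₄/Z_i` along the jet `q`: it is the expansion of
`z₄ * exp (ξ₄' t + ξ₄'' t ^ 2 / 2 + ξ₄''' t ^ 3 / 6)`. -/
noncomputable def last {d : ℕ} (q : Ambient d) : ℂ⟦X⟧ :=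
  C (xi4 q 0) * (1 + C (xi4 q 1) * X + C ((xi4 q 2 + xi4 q 1 ^ 2) / 2) * X ^ 2
    + C ((xi4 q 3 + 3 * xi4 q 1 * xi4 q 2 + xi4 q 1 ^ 3) / 6) * X ^ 3)

/-- The equation `Z₄ ^ d + ∑ a_α Z ^ α` of the family along the jet `q`, in the chart
`{Z_i ≠ 0}`. -/
noncomputable def equation {d : ℕ} (i : Fin 4) (q : Ambient d) : ℂ⟦X⟧ :=
  last q ^ d + ∑ α : MultiIndex d, C (param q α) * ∏ m, base i q m ^ (α.1 m : ℕ)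

/-- The vertical logarithmic 3-jets of `(𝒴, H)`, in the chart `{Z_i ≠ 0}`: the parameter is
nonzero (it lies in `U`), and the equation of `𝒴` vanishes to order `3` along the jet. The four
charts `i = 0, 1, 2, 3` cover everything, as the point `[0 : 0 : 0 : 0 : 1]` is not on `𝒴`. -/
def jets (d : ℕ) (i : Fin 4) : Set (Ambient d) :=
  {q | (∃ α, param q α ≠ 0) ∧ ∀ k : Fin 4, coeff (k : ℕ) (equation i q) = 0}

/-- The tangent space of the jet space at `q`, in the chart `{Z_i ≠ 0}`: the kernel of the
differentials of the four defining equations. -/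
noncomputable def tangent {d : ℕ} (i : Fin 4) (q : Ambient d) : Submodule ℂ (Ambient d) :=
  ⨅ k : Fin 4, LinearMap.ker
    (fderiv ℂ (fun q' : Ambient d => coeff (k : ℕ) (equation i q')) q).toLinearMap

/-- The value of `Z_j / Z_i` at the point under the jet `q`. -/
noncomputable def ratio {d : ℕ} (i j : Fin 4) (q : Ambient d) : ℂ :=
  constantCoeff (base i q j)

/-- Change of coordinates from the chart `{Z_i ≠ 0}` to the chart `{Z_j ≠ 0}`, defined where
`ratio i j q ≠ 0`. The logarithmic coordinates follow
`d log (Z₄/Z_j) = d log (Z₄/Z_i) - d log (Z_j/Z_i)`. -/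
noncomputable def change {d : ℕ} (i j : Fin 4) (q : Ambient d) : Ambient d :=
  Sum.elim (fun α => param q α) <| Sum.elim
    (fun mk => ((mk.2 : ℕ).factorial : ℂ) *
      coeff (mk.2 : ℕ) (base i q (j.succAbove mk.1) * (base i q j)⁻¹))
    (Fin.cases (xi4 q 0 / ratio i j q) fun k : Fin 3 =>
      xi4 q k.succ - ((k : ℕ).factorial : ℂ) *
        coeff (k : ℕ) (d⁄dX ℂ (base i q j) * (base i q j)⁻¹))

/-- The part of the Wronskian-degenerate locus over `{Z₀ ≠ 0}`. -/
def sigmaZero (d : ℕ) : Set (Ambient d) :=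
  {q | q ∈ jets d 0 ∧ (Matrix.of fun m k : Fin 3 => xi q m k.succ).det = 0}

/-- The Wronskian-degenerate locus `Σ`, the closure of `sigmaZero` in the whole jet space, seen in
the chart `{Z_i ≠ 0}`. -/
def sigma (d : ℕ) (i : Fin 4) : Set (Ambient d) :=
  closure {q | q ∈ jets d i ∧ ratio i 0 q ≠ 0 ∧ change i 0 q ∈ sigmaZero d}

/-- The preimage of the boundary divisor `H = {Z₄ = 0}` (in any chart). -/
def overH (d : ℕ) : Set (Ambient d) := {q | xi4 q 0 = 0}

/-- A global section of `T ⊗ 𝒪_{ℙ⁴}(c) ⊗ 𝒪(*)` on the vertical logarithmic 3-jet space `J` of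
`(𝒴, H)`. In the chart `{Z_i ≠ 0}` it is `V_i ⊗ Z_i ^ c`, where `V_i` is a vector field with
polynomial coefficients, tangent to `J` at every point of `J`; on overlaps
`V_i = (Z_j / Z_i) ^ c V_j`. The degree in the parameters `a_α` is not bounded, so that poles of
any finite order are allowed along the hyperplane at infinity of the parameter space. -/
structure TwistedField (d c : ℕ) where
  /-- the coefficients of `V_i` -/
  coef : Fin 4 → Coord d → MvPolynomial (Coord d) ℂ
  tangent_mem : ∀ i, ∀ q ∈ jets d i,
    (fun x => MvPolynomial.eval q (coef i x)) ∈ tangent i q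
  glue : ∀ i j, ∀ q ∈ jets d i, ratio i j q ≠ 0 →
    fderiv ℂ (change i j) q (fun x => MvPolynomial.eval q (coef i x)) =
      ratio i j q ^ c • fun x => MvPolynomial.eval (change i j q) (coef j x)

/-- The value of a section at `q`, in the trivialisation of the chart `{Z_i ≠ 0}`. -/
noncomputable def TwistedField.value {d c : ℕ} (s : TwistedField d c) (i : Fin 4)
    (q : Ambient d) : Ambient d :=
  fun x => MvPolynomial.eval q (s.coef i x)

end LogJet

/-! Write the jet as four power series `Z_m / Z_i` modulo `t ^ 4` together with the logarithm of
`Z_4 / Z_i`. Off `Σ` the Wronskian, the determinant of the 4 × 4 matrix of Taylor coefficients of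
`Z_0, …, Z_3`, is nonzero (`det_coefMat_ne_zero`). Off `H` every tangent vector is a variation of
the parameters, of these series and of that logarithm (`exists_eq_vec`). Two families of sections
then suffice.

The algebra `𝔤𝔩₄` acts on `Z_0, …, Z_3`, and a compensating action on the parameters preserves the
equation; multiplication by `Z_l ^ 12` gives the twist (`exists_linear_twistedField`). When the
Wronskian is nonzero, a matrix can send the four series to any four prescribed series modulo `t ^
4`, so these sections realise every variation of the jet, up to a change of the parameters.

What remains is a variation of the parameters alone, that is, a form of degree `d` vanishing to
order 3 along the jet. The inverse Wronskian matrix, cleared of denominators, gives linear forms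
`ℓ_k` proportional to `t ^ k` along the jet. The quadrics `ℓ_a ℓ_b - ℓ_0 ℓ_{a+b}` vanish there to
order 3, and their multiples exhaust the forms that do (`mem_quadSpan`). With `ℓ_k` normalised to
have degree 4, a quadric has degree 8 in the jet, within the allowed 12
(`exists_param_twistedField`). -/

namespace LogJet

variable {d : ℕ}

/-! ### Directional derivatives of families of power series. -/

section Calculus

variable {E : Type*} [NormedAddCommGroup E] [NormedSpace ℂ E]

/-- `f` is differentiable at `q`, with derivative `f'` in the direction `v`. -/
def HasDirDeriv (f : E → ℂ) (q v : E) (f' : ℂ) : Prop :=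
  DifferentiableAt ℂ f q ∧ fderiv ℂ f q v = f'

namespace HasDirDeriv

variable {f g : E → ℂ} {q v : E} {f' g' : ℂ}

lemma const (c : ℂ) : HasDirDeriv (fun _ => c) q v 0 := by
  refine ⟨differentiableAt_const c, ?_⟩
  simp

lemma add (hf : HasDirDeriv f q v f') (hg : HasDirDeriv g q v g') :
    HasDirDeriv (fun p => f p + g p) q v (f' + g') := by
  refine ⟨hf.1.add hg.1, ?_⟩
  rw [fderiv_fun_add hf.1 hg.1, ← hf.2, ← hg.2]
  rfl

lemma sub (hf : HasDirDeriv f q v f') (hg : HasDirDeriv g q v g') :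
    HasDirDeriv (fun p => f p - g p) q v (f' - g') := by
  refine ⟨hf.1.sub hg.1, ?_⟩
  rw [fderiv_fun_sub hf.1 hg.1, ← hf.2, ← hg.2]
  rfl

lemma mul (hf : HasDirDeriv f q v f') (hg : HasDirDeriv g q v g') :
    HasDirDeriv (fun p => f p * g p) q v (f' * g q + f q * g') := by
  refine ⟨hf.1.mul hg.1, ?_⟩
  rw [fderiv_fun_mul hf.1 hg.1, ← hf.2, ← hg.2]
  simp only [add_apply, smul_apply, smul_eq_mul]
  ring

lemma const_mul (c : ℂ) (hf : HasDirDeriv f q v f') :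
    HasDirDeriv (fun p => c * f p) q v (c * f') := by
  simpa using (const (q := q) (v := v) c).mul hf

lemma congr_deriv (hf : HasDirDeriv f q v f') (h : f' = g') : HasDirDeriv f q v g' := h ▸ hf

lemma congr (hf : HasDirDeriv f q v f') (h : f =ᶠ[nhds q] g) : HasDirDeriv g q v f' :=
  ⟨hf.1.congr_of_eventuallyEq h.symm, by rw [← h.fderiv_eq, hf.2]⟩

lemma sum {ι : Type*} {s : Finset ι} {F : ι → E → ℂ} {F' : ι → ℂ}
    (h : ∀ a ∈ s, HasDirDeriv (F a) q v (F' a)) :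
    HasDirDeriv (fun p => ∑ a ∈ s, F a p) q v (∑ a ∈ s, F' a) := by
  classical
  induction s using Finset.induction_on with
  | empty => simpa using const (q := q) (v := v) 0
  | insert a s ha ih =>
    simp only [Finset.sum_insert ha]
    exact (h a (by simp)).add (ih fun b hb => h b (by simp [hb]))

lemma unique (hf : HasDirDeriv f q v f') (hg : HasDirDeriv f q v g') : f' = g' :=
  hf.2.symm.trans hg.2

lemma inv (hf : HasDirDeriv f q v f') (h0 : f q ≠ 0) :
    HasDirDeriv (fun p => (f p)⁻¹) q v (-f' / f q ^ 2) := by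
  refine ⟨hf.1.inv h0, ?_⟩
  have h := ((hasDerivAt_inv h0).comp_hasFDerivAt q hf.1.hasFDerivAt).fderiv
  have h2 : (fun p => (f p)⁻¹) = Inv.inv ∘ f := rfl
  rw [h2, h, smul_apply, hf.2, smul_eq_mul]
  ring

end HasDirDeriv

/-- The coefficients of order `< n` of the family `F` of power series are differentiable at `q`,
and their derivatives in the direction `v` are the coefficients of `F'`. -/
def HasJetDeriv (n : ℕ) (F : E → ℂ⟦X⟧) (q v : E) (F' : ℂ⟦X⟧) : Prop :=
  ∀ k < n, HasDirDeriv (fun p => coeff k (F p)) q v (coeff k F')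

namespace HasJetDeriv

variable {n : ℕ} {F G : E → ℂ⟦X⟧} {q v : E} {F' G' : ℂ⟦X⟧}

lemma const (c : ℂ⟦X⟧) : HasJetDeriv n (fun _ => c) q v 0 := fun k _ => by
  simpa using HasDirDeriv.const (q := q) (v := v) (coeff k c)

lemma constantCoeff {f : E → ℂ} {f' : ℂ} (hf : HasDirDeriv f q v f') :
    HasJetDeriv n (fun p => C (f p)) q v (C f') := by
  intro k _
  rcases Nat.eq_zero_or_pos k with rfl | hk
  · simpa using hf
  · simpa [coeff_C, hk.ne'] using HasDirDeriv.const (q := q) (v := v) 0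

lemma add (hF : HasJetDeriv n F q v F') (hG : HasJetDeriv n G q v G') :
    HasJetDeriv n (fun p => F p + G p) q v (F' + G') := fun k hk => by
  simpa using (hF k hk).add (hG k hk)

lemma mul (hF : HasJetDeriv n F q v F') (hG : HasJetDeriv n G q v G') :
    HasJetDeriv n (fun p => F p * G p) q v (F' * G q + F q * G') := fun k hk => by
  simp only [coeff_mul, map_add, ← Finset.sum_add_distrib]
  refine HasDirDeriv.sum fun a ha => ?_
  have := Finset.HasAntidiagonal.mem_antidiagonal.1 ha
  exact (hF a.1 (by omega)).mul (hG a.2 (by omega))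

lemma congr_deriv (hF : HasJetDeriv n F q v F') (h : ∀ k < n, coeff k F' = coeff k G') :
    HasJetDeriv n F q v G' := fun k hk => (hF k hk).congr_deriv (h k hk)

lemma sum {ι : Type*} {s : Finset ι} {F : ι → E → ℂ⟦X⟧} {F' : ι → ℂ⟦X⟧}
    (h : ∀ a ∈ s, HasJetDeriv n (F a) q v (F' a)) :
    HasJetDeriv n (fun p => ∑ a ∈ s, F a p) q v (∑ a ∈ s, F' a) := fun k hk => by
  simp only [map_sum]
  exact HasDirDeriv.sum fun a ha => h a ha k hk

lemma pow (hF : HasJetDeriv n F q v F') (m : ℕ) :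
    HasJetDeriv n (fun p => F p ^ m) q v (m * F q ^ (m - 1) * F') := by
  induction m with
  | zero => simpa using const (n := n) (q := q) (v := v) 1
  | succ m ih =>
    simp only [pow_succ _ m]
    refine (ih.mul hF).congr_deriv fun k _ => ?_
    congr 1
    cases m with
    | zero => simp
    | succ m =>
      rw [Nat.add_sub_cancel, Nat.add_sub_cancel]
      push_cast
      ring

lemma aeval {σ : Type*} [Fintype σ] {Z : E → σ → ℂ⟦X⟧} {B : σ → ℂ⟦X⟧}
    (hZ : ∀ m, HasJetDeriv n (fun p => Z p m) q v (B m)) (P : MvPolynomial σ ℂ) :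
    HasJetDeriv n (fun p => MvPolynomial.aeval (Z p) P) q v
      (∑ m, MvPolynomial.aeval (Z q) (MvPolynomial.pderiv m P) * B m) := by
  classical
  induction P using MvPolynomial.induction_on with
  | C a => simpa using const (n := n) (q := q) (v := v) (algebraMap ℂ ℂ⟦X⟧ a)
  | add P Q hP hQ =>
    simpa [add_mul, Finset.sum_add_distrib] using hP.add hQ
  | mul_X P m hP =>
    simp only [map_mul, MvPolynomial.aeval_X]
    refine (hP.mul (hZ m)).congr_deriv fun k _ => ?_
    congr 1
    simp only [MvPolynomial.pderiv_mul, MvPolynomial.pderiv_X, map_add, map_mul,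
      MvPolynomial.aeval_X, add_mul, Finset.sum_add_distrib, Finset.sum_mul]
    congr 1
    · exact Finset.sum_congr rfl fun x _ => by ring
    · rw [Finset.sum_eq_single m]
      · simp
      · intro b _ hb
        simp [hb.symm]
      · simp

lemma derivative (hF : HasJetDeriv (n + 1) F q v F') :
    HasJetDeriv n (fun p => d⁄dX ℂ (F p)) q v (d⁄dX ℂ F') := fun k hk => by
  simp only [coeff_derivative]
  simpa [mul_comm] using (hF (k + 1) (by omega)).const_mul ((k : ℂ) + 1)

/-- The recursion for the coefficients of the inverse gives differentiability; differentiating `F *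
F⁻¹ = 1` and solving modulo `X ^ n` then gives the derivative. -/
lemma inv (hF : HasJetDeriv n F q v F') (h0 : PowerSeries.constantCoeff (F q) ≠ 0) :
    HasJetDeriv n (fun p => (F p)⁻¹) q v (-F' * (F q)⁻¹ ^ 2) := by
  have hdiff : ∀ k, k < n → DifferentiableAt ℂ (fun p => coeff k (F p)⁻¹) q := by
    intro k
    induction k using Nat.strong_induction_on with
    | _ k ih =>
      intro hk
      have hF0 : DifferentiableAt ℂ (fun p => (PowerSeries.constantCoeff (F p))⁻¹) q := by
        have := (hF 0 (by omega)).1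
        simp only [coeff_zero_eq_constantCoeff] at this
        exact this.inv h0
      rw [funext fun p => PowerSeries.coeff_inv k (F p)]
      split_ifs with hk0
      · exact hF0
      · refine hF0.neg.mul (DifferentiableAt.fun_sum fun x hx => ?_)
        have hx' := Finset.HasAntidiagonal.mem_antidiagonal.1 hx
        split_ifs with hlt
        · exact (hF x.1 (by omega)).1.mul (ih x.2 hlt (by omega))
        · exact differentiableAt_const 0
  let G' : ℂ⟦X⟧ := PowerSeries.mk fun k => fderiv ℂ (fun p => coeff k (F p)⁻¹) q v
  have hG : HasJetDeriv n (fun p => (F p)⁻¹) q v G' := fun k hk =>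
    ⟨hdiff k hk, by simp [G']⟩
  refine hG.congr_deriv ?_
  -- The product is 1 only near `q`: where the constant coefficient vanishes, the inverse takes its
  -- default value 0.
  have hone : HasJetDeriv n (fun p => F p * (F p)⁻¹) q v 0 := by
    intro k hk
    refine (const (n := n) (q := q) (v := v) 1 k hk).congr ?_
    have hc : ContinuousAt (fun p => PowerSeries.constantCoeff (F p)) q := by
      have := (hF 0 (by omega)).1.continuousAt
      simpa only [coeff_zero_eq_constantCoeff] using this
    filter_upwards [hc.eventually_ne h0] with p hp
    rw [PowerSeries.mul_inv_cancel _ hp]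
  have hmul : ∀ k < n, coeff k (F' * (F q)⁻¹ + F q * G') = 0 := fun k hk => by
    simpa using (((hF.mul hG) k hk).unique (hone k hk))
  have hdvd : (X : ℂ⟦X⟧) ^ n ∣ F' * (F q)⁻¹ + F q * G' := X_pow_dvd_iff.2 hmul
  have hdvd2 : (X : ℂ⟦X⟧) ^ n ∣ G' - -F' * (F q)⁻¹ ^ 2 := by
    have h1 := PowerSeries.mul_inv_cancel _ h0
    have : G' - -F' * (F q)⁻¹ ^ 2 = (F q)⁻¹ * (F' * (F q)⁻¹ + F q * G') := by
      linear_combination (-G') * h1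
    rw [this]
    exact hdvd.mul_left _
  intro k hk
  have := X_pow_dvd_iff.1 hdvd2 k hk
  rwa [map_sub, sub_eq_zero] at this

end HasJetDeriv

end Calculus

/-! ### Series modulo `t ^ 4`, and forms of degree `d` as coefficient vectors. -/

/-- Truncation of power series to order `3`. -/
noncomputable abbrev trunc4 : ℂ⟦X⟧ →ₐ[ℂ] ℂ⟦X⟧ ⧸ Ideal.span {(X : ℂ⟦X⟧) ^ 4} :=
  Ideal.Quotient.mkₐ ℂ _

lemma trunc4_eq_iff {F G : ℂ⟦X⟧} : trunc4 F = trunc4 G ↔ ∀ k < 4, coeff k F = coeff k G := by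
  rw [Ideal.Quotient.mkₐ_eq_mk, Ideal.Quotient.eq, Ideal.mem_span_singleton, X_pow_dvd_iff]
  simp [sub_eq_zero]

lemma trunc4_X_pow {k : ℕ} (hk : 4 ≤ k) : trunc4 ((X : ℂ⟦X⟧) ^ k) = 0 := by
  rw [← map_zero trunc4, trunc4_eq_iff]
  intro l hl
  simp [coeff_X_pow, show l ≠ k by omega]

lemma trunc4_aeval {Z Z' : Fin 4 → ℂ⟦X⟧} (h : ∀ m, trunc4 (Z m) = trunc4 (Z' m))
    (P : MvPolynomial (Fin 4) ℂ) :
    trunc4 (MvPolynomial.aeval Z P) = trunc4 (MvPolynomial.aeval Z' P) := by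
  rw [← AlgHom.comp_apply, ← AlgHom.comp_apply, MvPolynomial.comp_aeval, MvPolynomial.comp_aeval]
  simp only [h]

/-- The exponent vector of a multi-index. -/
noncomputable def expo (α : MultiIndex d) : Fin 4 →₀ ℕ :=
  Finsupp.equivFunOnFinite.symm fun m => (α.1 m : ℕ)

@[simp] lemma expo_apply (α : MultiIndex d) (m : Fin 4) : expo α m = α.1 m := rfl

lemma expo_injective : Function.Injective (expo (d := d)) := fun α β h => by
  refine Subtype.ext (funext fun m => Fin.ext ?_)
  simpa using DFunLike.congr_fun h m

lemma degree_expo (α : MultiIndex d) : (expo α).degree = d := by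
  rw [Finsupp.degree_eq_sum]
  simpa using α.2

lemma exists_expo {β : Fin 4 →₀ ℕ} (hβ : β.degree = d) : ∃ α : MultiIndex d, expo α = β := by
  rw [Finsupp.degree_eq_sum] at hβ
  refine ⟨⟨fun m => ⟨β m, ?_⟩, by simpa using hβ⟩, by ext m; simp⟩
  have : β m ≤ ∑ m, β m := Finset.single_le_sum (fun _ _ => Nat.zero_le _) (Finset.mem_univ m)
  omega

/-- The homogeneous polynomial of degree `d` with given coefficients. -/
noncomputable def poly (c : MultiIndex d → ℂ) : MvPolynomial (Fin 4) ℂ :=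
  ∑ α, MvPolynomial.monomial (expo α) (c α)

/-- The coefficients of degree `d` of a polynomial. -/
noncomputable def coeffs (d : ℕ) (P : MvPolynomial (Fin 4) ℂ) : MultiIndex d → ℂ :=
  fun α => MvPolynomial.coeff (expo α) P

lemma isHomogeneous_poly (c : MultiIndex d → ℂ) : (poly c).IsHomogeneous d :=
  MvPolynomial.IsHomogeneous.sum _ _ _ fun α _ =>
    MvPolynomial.isHomogeneous_monomial _ (degree_expo α)

lemma coeffs_poly (c : MultiIndex d → ℂ) : coeffs d (poly c) = c := by
  classical
  ext α
  simp [coeffs, poly, MvPolynomial.coeff_sum, MvPolynomial.coeff_monomial, expo_injective.eq_iff]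

lemma poly_coeffs {P : MvPolynomial (Fin 4) ℂ} (hP : P.IsHomogeneous d) :
    poly (coeffs d P) = P := by
  ext β
  by_cases hβ : β.degree = d
  · obtain ⟨α, rfl⟩ := exists_expo hβ
    exact congr_fun (coeffs_poly (coeffs d P)) α
  · rw [hP.coeff_eq_zero hβ, (isHomogeneous_poly _).coeff_eq_zero hβ]

lemma aeval_poly (c : MultiIndex d → ℂ) (Z : Fin 4 → ℂ⟦X⟧) :
    MvPolynomial.aeval Z (poly c) = ∑ α, C (c α) * ∏ m, Z m ^ (α.1 m : ℕ) := by
  simp only [poly, map_sum, MvPolynomial.aeval_monomial]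
  refine Finset.sum_congr rfl fun α _ => ?_
  rw [Finsupp.prod_fintype _ _ fun _ => pow_zero _]
  rfl

lemma aeval_poly_eq_sum (c : MultiIndex d → ℂ) (Z : Fin 4 → ℂ⟦X⟧) :
    MvPolynomial.aeval Z (poly c) =
      ∑ α, C (c α) * MvPolynomial.aeval Z (MvPolynomial.monomial (expo α) (1 : ℂ)) := by
  rw [poly, map_sum]
  refine Finset.sum_congr rfl fun α _ => ?_
  rw [← mul_one (c α), ← MvPolynomial.C_mul_monomial, map_mul, MvPolynomial.aeval_C, mul_one]
  rfl

lemma equation_eq (i : Fin 4) (q : Ambient d) :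
    equation i q = last q ^ d + MvPolynomial.aeval (base i q) (poly (param q)) := by
  rw [aeval_poly]
  rfl

@[simp] lemma base_self (i : Fin 4) (q : Ambient d) : base i q i = 1 := by simp [base]

lemma coeff_base (i : Fin 4) (q : Ambient d) (m : Fin 3) (k : Fin 4) :
    coeff (k : ℕ) (base i q (i.succAbove m)) = xi q m k / ((k : ℕ).factorial : ℂ) := by
  fin_cases k <;>
    simp [base, coeff_X_pow, coeff_C, Nat.factorial, coeff_zero_eq_constantCoeff]

/-! ### Tangent vectors as variations of series, and the differential of the equation. -/

/-- The tangent vector at `q` of the chart `{Z_i ≠ 0}` with variation `c` of the parameters,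
variation `B` of the expansions of the `Z_m / Z_i`, and variation `L` of the logarithm of the
expansion of `Z₄ / Z_i`. -/
noncomputable def vec (i : Fin 4) (q : Ambient d) (c : MultiIndex d → ℂ) (B : Fin 4 → ℂ⟦X⟧)
    (L : ℂ⟦X⟧) : Ambient d :=
  Sum.elim c <| Sum.elim
    (fun mk => ((mk.2 : ℕ).factorial : ℂ) * coeff (mk.2 : ℕ) (B (i.succAbove mk.1)))
    (Fin.cases (xi4 q 0 * coeff 0 L) fun k : Fin 3 =>
      (((k : ℕ) + 1).factorial : ℂ) * coeff ((k : ℕ) + 1) L)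

lemma vec_congr {i : Fin 4} {q : Ambient d} {c : MultiIndex d → ℂ} {B B' : Fin 4 → ℂ⟦X⟧}
    {L L' : ℂ⟦X⟧} (hB : ∀ m, trunc4 (B m) = trunc4 (B' m)) (hL : trunc4 L = trunc4 L') :
    vec i q c B L = vec i q c B' L' := by
  simp only [trunc4_eq_iff] at hB hL
  funext x
  rcases x with α | ⟨m, k⟩ | k
  · rfl
  · simp [vec, hB _ k k.2]
  · refine Fin.cases ?_ (fun k => ?_) k
    · simp only [vec, Sum.elim_inr, Fin.cases_zero, hL 0 (by omega)]
    · simp only [vec, Sum.elim_inr, Fin.cases_succ, hL (k + 1) (by omega)]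

section Derivatives

variable (i : Fin 4) (q : Ambient d) (c : MultiIndex d → ℂ) (B : Fin 4 → ℂ⟦X⟧) (L : ℂ⟦X⟧)

lemma hasDirDeriv_coord (v : Ambient d) (x : Coord d) :
    HasDirDeriv (fun p : Ambient d => p x) q v (v x) :=
  ⟨differentiableAt_apply x q, by
    rw [(hasFDerivAt_apply x q).fderiv]
    rfl⟩

lemma hasDirDeriv_param (α : MultiIndex d) :
    HasDirDeriv (fun p => param p α) q (vec i q c B L) (c α) :=
  hasDirDeriv_coord q _ _

lemma hasDirDeriv_xi (m : Fin 3) (k : Fin 4) :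
    HasDirDeriv (fun p => xi p m k) q (vec i q c B L)
      (((k : ℕ).factorial : ℂ) * coeff (k : ℕ) (B (i.succAbove m))) :=
  hasDirDeriv_coord q _ _

lemma hasDirDeriv_xi4_zero :
    HasDirDeriv (fun p => xi4 p 0) q (vec i q c B L) (xi4 q 0 * coeff 0 L) :=
  hasDirDeriv_coord q _ _

lemma hasDirDeriv_xi4_succ (k : Fin 3) :
    HasDirDeriv (fun p => xi4 p k.succ) q (vec i q c B L)
      ((((k : ℕ) + 1).factorial : ℂ) * coeff ((k : ℕ) + 1) L) :=
  hasDirDeriv_coord q _ _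

variable {B} in
lemma hasJetDeriv_base (hB : B i = 0) (m : Fin 4) :
    HasJetDeriv 4 (fun p => base i p m) q (vec i q c B L) (B m) := by
  rcases Fin.eq_self_or_eq_succAbove i m with rfl | ⟨m, rfl⟩
  · simpa [hB] using HasJetDeriv.const (n := 4) (q := q) (v := vec m q c B L) 1
  · intro k hk
    lift k to Fin 4 using hk
    simp only [coeff_base, div_eq_inv_mul]
    refine ((hasDirDeriv_xi i q c B L m k).const_mul _).congr_deriv ?_
    rw [inv_mul_cancel_left₀ (Nat.cast_ne_zero.2 (Nat.factorial_ne_zero _))]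

lemma coeff_last (q : Ambient d) :
    coeff 0 (last q) = xi4 q 0 ∧ coeff 1 (last q) = xi4 q 0 * xi4 q 1 ∧
    coeff 2 (last q) = xi4 q 0 * ((xi4 q 2 + xi4 q 1 ^ 2) / 2) ∧
    coeff 3 (last q) =
      xi4 q 0 * ((xi4 q 3 + 3 * xi4 q 1 * xi4 q 2 + xi4 q 1 ^ 3) / 6) := by
  refine ⟨?_, ?_, ?_, ?_⟩ <;>
    simp [last, coeff_X_pow, coeff_one, coeff_C, coeff_zero_eq_constantCoeff]

lemma coeff_mul_of_lt_four (F G : ℂ⟦X⟧) :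
    coeff 0 (F * G) = coeff 0 F * coeff 0 G ∧
    coeff 1 (F * G) = coeff 0 F * coeff 1 G + coeff 1 F * coeff 0 G ∧
    coeff 2 (F * G) = coeff 0 F * coeff 2 G + coeff 1 F * coeff 1 G + coeff 2 F * coeff 0 G ∧
    coeff 3 (F * G) = coeff 0 F * coeff 3 G + coeff 1 F * coeff 2 G + coeff 2 F * coeff 1 G +
      coeff 3 F * coeff 0 G := by
  refine ⟨?_, ?_, ?_, ?_⟩ <;>
    simp [coeff_mul, Finset.Nat.sum_antidiagonal_eq_sum_range_succ_mk, Finset.sum_range_succ]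

/-- This is the logarithmic derivative: `last` is an exponential modulo `t ^ 4`, and `L` varies its
exponent. Here the logarithmic coordinates become linear. -/
lemma hasJetDeriv_last : HasJetDeriv 4 last q (vec i q c B L) (last q * L) := by
  have h0 := hasDirDeriv_xi4_zero i q c B L
  have h1 := hasDirDeriv_xi4_succ i q c B L 0
  have h2 := hasDirDeriv_xi4_succ i q c B L 1
  have h3 := hasDirDeriv_xi4_succ i q c B L 2
  simp only [Fin.succ_zero_eq_one, Fin.succ_one_eq_two, show Fin.succ 2 = (3 : Fin 4) from rfl]
    at h1 h2 h3
  have e := fun p : Ambient d => coeff_last p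
  obtain ⟨m0, m1, m2, m3⟩ := coeff_mul_of_lt_four (last q) L
  obtain ⟨e0, e1, e2, e3⟩ := e q
  intro k hk
  interval_cases k
  · simp only [(e _).1, m0]
    exact h0
  · simp only [(e _).2.1, m1, e0]
    refine (h0.mul h1).congr_deriv ?_
    simp [Nat.factorial]
    ring
  · simp only [(e _).2.2.1, m2, e0, e1, div_eq_inv_mul, sq]
    refine (h0.mul ((h2.add (h1.mul h1)).const_mul _)).congr_deriv ?_
    simp [Nat.factorial]
    ring
  · simp only [(e _).2.2.2, m3, e0, e1, e2, div_eq_inv_mul, pow_succ, pow_zero, one_mul]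
    refine (h0.mul (((h3.add ((h1.const_mul 3).mul h2)).add
      ((h1.mul h1).mul h1)).const_mul _)).congr_deriv ?_
    simp [Nat.factorial]
    ring

variable {B} in
lemma hasJetDeriv_equation (hB : B i = 0) :
    HasJetDeriv 4 (equation i) q (vec i q c B L)
      (d * last q ^ d * L + MvPolynomial.aeval (base i q) (poly c) +
        ∑ m, MvPolynomial.aeval (base i q) (MvPolynomial.pderiv m (poly (param q))) * B m) := by
  have hmon : ∀ α : MultiIndex d, HasJetDeriv 4
      (fun p => MvPolynomial.aeval (base i p) (MvPolynomial.monomial (expo α) (1 : ℂ))) q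
        (vec i q c B L) _ := fun α =>
    HasJetDeriv.aeval (fun m => hasJetDeriv_base i q c L hB m) _
  have hexp : ∀ (a : MultiIndex d → ℂ) (Z : Fin 4 → ℂ⟦X⟧), MvPolynomial.aeval Z (poly a) =
      ∑ α, C (a α) * MvPolynomial.aeval Z (MvPolynomial.monomial (expo α) (1 : ℂ)) :=
    aeval_poly_eq_sum
  have heq : equation (d := d) i = fun p => last p ^ d + ∑ α, C (param p α) *
      MvPolynomial.aeval (base i p) (MvPolynomial.monomial (expo α) (1 : ℂ)) := by
    funext p
    rw [equation_eq, hexp]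
  rw [heq]
  refine (((hasJetDeriv_last i q c B L).pow d).add (HasJetDeriv.sum fun α _ =>
    (HasJetDeriv.constantCoeff (hasDirDeriv_param i q c B L α)).mul (hmon α))).congr_deriv ?_
  intro k _
  congr 1
  rw [add_assoc, hexp]
  congr 1
  · cases d with
    | zero => simp
    | succ d => simp only [Nat.add_sub_cancel, pow_succ]; ring
  · rw [Finset.sum_add_distrib]
    congr 1
    simp only [Finset.mul_sum]
    rw [Finset.sum_comm]
    refine Finset.sum_congr rfl fun m _ => ?_
    simp only [← mul_assoc, ← Finset.sum_mul]
    congr 1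
    rw [poly, map_sum, map_sum]
    refine Finset.sum_congr rfl fun α _ => ?_
    rw [← mul_one (param q α), ← MvPolynomial.C_mul_monomial, MvPolynomial.pderiv_C_mul,
      mul_one, map_mul, MvPolynomial.aeval_C]
    rfl

end Derivatives

/-! ### Change of charts and its differential. -/

lemma ratio_eq (i j : Fin 4) (q : Ambient d) : ratio i j q = constantCoeff (base i q j) := rfl

lemma base_change {i j : Fin 4} {q : Ambient d} (h : ratio i j q ≠ 0) (m : Fin 4) :
    trunc4 (base j (change i j q) m) = trunc4 (base i q m * (base i q j)⁻¹) := by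
  rcases Fin.eq_self_or_eq_succAbove j m with rfl | ⟨m, rfl⟩
  · rw [PowerSeries.mul_inv_cancel _ h, base_self]
  · rw [trunc4_eq_iff]
    intro k hk
    lift k to Fin 4 using hk
    rw [coeff_base]
    simp only [xi, change, Sum.elim_inr, Sum.elim_inl]
    rw [mul_div_cancel_left₀ _ (Nat.cast_ne_zero.2 (Nat.factorial_ne_zero _))]

lemma param_change (i j : Fin 4) (q : Ambient d) : param (change i j q) = param q := rfl

lemma xi4_zero_change (i j : Fin 4) (q : Ambient d) :
    xi4 (change i j q) 0 = xi4 q 0 / ratio i j q := rfl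

lemma xi4_succ_change (i j : Fin 4) (q : Ambient d) (k : Fin 3) :
    xi4 (change i j q) k.succ = xi4 q k.succ - ((k : ℕ).factorial : ℂ) *
        coeff (k : ℕ) (d⁄dX ℂ (base i q j) * (base i q j)⁻¹) := rfl

lemma coeff_eq_of_trunc4 {F G : ℂ⟦X⟧} (h : trunc4 F = trunc4 G) {k : ℕ} (hk : k < 4) :
    coeff k F = coeff k G := trunc4_eq_iff.1 h k hk

lemma ratio_change {i j : Fin 4} {q : Ambient d} (h : ratio i j q ≠ 0) (m : Fin 4) :
    ratio j m (change i j q) = ratio i m q * (ratio i j q)⁻¹ := by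
  have := coeff_eq_of_trunc4 (base_change h m) (k := 0) (by norm_num)
  simpa only [coeff_zero_eq_constantCoeff, map_mul, constantCoeff_inv, ratio] using this

/-- The differential of the change of charts. -/
lemma fderiv_change {i j : Fin 4} {q : Ambient d} (h : ratio i j q ≠ 0) (c : MultiIndex d → ℂ)
    {B : Fin 4 → ℂ⟦X⟧} (hB : B i = 0) (L : ℂ⟦X⟧) :
    fderiv ℂ (change i j) q (vec i q c B L) = vec j (change i j q) c
      (fun m => B m * (base i q j)⁻¹ - base i q m * B j * (base i q j)⁻¹ ^ 2)
      (L - B j * (base i q j)⁻¹) := by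
  set v := vec i q c B L with hv
  set B' : Fin 4 → ℂ⟦X⟧ :=
    fun m => B m * (base i q j)⁻¹ - base i q m * B j * (base i q j)⁻¹ ^ 2 with hB'
  set L' := L - B j * (base i q j)⁻¹ with hL'
  have hb : ∀ m, HasJetDeriv 4 (fun p => base i p m) q v (B m) := fun m =>
    hasJetDeriv_base i q c L hB m
  have key : ∀ x, HasDirDeriv (fun p => change i j p x) q v (vec j (change i j q) c B' L' x) := by
    rintro (α | ⟨m, k⟩ | k)
    · exact hasDirDeriv_param i q c B L α
    · refine ((((hb _).mul ((hb j).inv h)) k k.2).const_mul _).congr_deriv ?_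
      simp only [vec, Sum.elim_inr, Sum.elim_inl, hB']
      congr 2
      ring
    · refine Fin.cases ?_ (fun k => ?_) k
      · have h0 := (hasDirDeriv_xi4_zero i q c B L).mul
          (((hb j) 0 (by norm_num)).inv (by simpa only [coeff_zero_eq_constantCoeff, ratio] using h))
        refine (h0.congr_deriv ?_).congr (Filter.Eventually.of_forall fun p => ?_)
        · change _ = xi4 (change i j q) 0 * coeff 0 L'
          rw [xi4_zero_change, hL', ratio_eq]
          rw [ratio_eq] at h
          simp only [coeff_zero_eq_constantCoeff, map_sub, map_mul, constantCoeff_inv]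
          field_simp
          ring
        · simp only [coeff_zero_eq_constantCoeff]
          exact (div_eq_mul_inv _ _).symm
      -- The logarithmic derivative uses up one order of the jet, so the inverse is needed only to
      -- order 3; the bracket is the derivative of `B j / base i q j`.
      · refine ((hasDirDeriv_xi4_succ i q c B L k).sub
          ((((hb j).derivative.mul (HasJetDeriv.inv (n := 3) (fun l hl => hb j l (by omega)) h))
            k k.2).const_mul _)).congr_deriv ?_
        have : d⁄dX ℂ (B j) * (base i q j)⁻¹ +
            d⁄dX ℂ (base i q j) * (-B j * (base i q j)⁻¹ ^ 2) =
            d⁄dX ℂ (B j * (base i q j)⁻¹) := by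
          rw [Derivation.leibniz, derivative_inv', smul_eq_mul, smul_eq_mul]
          ring
        rw [this, coeff_derivative]
        simp only [vec, Sum.elim_inr, Fin.cases_succ, hL', map_sub, Nat.factorial_succ]
        push_cast
        ring
  have hd : DifferentiableAt ℂ (change (d := d) i j) q := differentiableAt_pi.2 fun x => (key x).1
  funext x
  rw [← (key x).2]
  exact (congrArg (fun f => f v) ((hasFDerivAt_pi'.1 hd.hasFDerivAt x).fderiv)).symm

lemma last_change {i j : Fin 4} {q : Ambient d} (h : ratio i j q ≠ 0) :
    trunc4 (last (change i j q)) = trunc4 (last q * (base i q j)⁻¹) := by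
  set r := base i q j with hr
  set s := r⁻¹ with hs
  obtain ⟨m0, m1, m2, m3⟩ := coeff_mul_of_lt_four (last q) s
  obtain ⟨e0, e1, e2, e3⟩ := coeff_last q
  obtain ⟨f0, f1, f2, f3⟩ := coeff_last (change i j q)
  obtain ⟨n0, n1, n2, -⟩ := coeff_mul_of_lt_four (d⁄dX ℂ r) s
  obtain ⟨u0, u1, u2, u3⟩ := coeff_mul_of_lt_four r s
  rw [show r * s = 1 from PowerSeries.mul_inv_cancel _ h] at u0 u1 u2 u3
  have x0 := xi4_zero_change i j q
  have x1 := xi4_succ_change i j q 0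
  have x2 := xi4_succ_change i j q 1
  have x3 := xi4_succ_change i j q 2
  simp only [Fin.succ_zero_eq_one, Fin.succ_one_eq_two, show Fin.succ 2 = (3 : Fin 4) from rfl,
    Fin.val_zero, Fin.val_one, Fin.val_two, ← hr, ← hs, n0, n1, n2, coeff_derivative]
    at x1 x2 x3
  have hr0 : ratio i j q = coeff 0 r := by rw [coeff_zero_eq_constantCoeff]; rfl
  rw [hr0] at x0 h
  rw [coeff_one, if_pos rfl] at u0
  rw [coeff_one, if_neg (by norm_num)] at u1 u2 u3
  -- Solving `r * s = 1` order by order removes the higher coefficients of `s`; the comparison then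
  -- becomes a polynomial identity.
  have s1 : coeff 1 s = -coeff 0 s * (coeff 1 r * coeff 0 s) := by
    linear_combination coeff 1 s * u0 - coeff 0 s * u1
  have s2 : coeff 2 s = -coeff 0 s * (coeff 1 r * coeff 1 s + coeff 2 r * coeff 0 s) := by
    linear_combination coeff 2 s * u0 - coeff 0 s * u2
  have s3 : coeff 3 s =
      -coeff 0 s * (coeff 1 r * coeff 2 s + coeff 2 r * coeff 1 s + coeff 3 r * coeff 0 s) := by
    linear_combination coeff 3 s * u0 - coeff 0 s * u3
  have x0' : xi4 (change i j q) 0 = xi4 q 0 * coeff 0 s := by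
    rw [x0, div_eq_iff h]
    linear_combination (xi4 q 0) * u0
  norm_num only [Nat.factorial] at x1 x2 x3
  rw [trunc4_eq_iff]
  intro k hk
  interval_cases k
  · rw [f0, m0, e0, x0']
  · rw [f1, m1, e0, e1, x0', x1, s1]
    ring
  · rw [f2, m2, e0, e1, e2, x0', x1, x2, s2, s1]
    ring
  · rw [f3, m3, e0, e1, e2, e3, x0', x1, x2, x3, s3, s2, s1]
    ring

/-! ### Polynomial dependence on the coordinates. -/

/-- `f` is a polynomial function of the coordinates. -/
def IsPoly (f : Ambient d → ℂ) : Prop := ∃ p : MvPolynomial (Coord d) ℂ, ∀ q, p.eval q = f q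

namespace IsPoly

variable {f g : Ambient d → ℂ}

lemma const (a : ℂ) : IsPoly fun _ : Ambient d => a := ⟨MvPolynomial.C a, fun q => by simp⟩

lemma coord (x : Coord d) : IsPoly fun q : Ambient d => q x := ⟨MvPolynomial.X x, fun q => by simp⟩

lemma add (hf : IsPoly f) (hg : IsPoly g) : IsPoly fun q => f q + g q := by
  obtain ⟨p, hp⟩ := hf
  obtain ⟨p', hp'⟩ := hg
  exact ⟨p + p', fun q => by simp [hp, hp']⟩

lemma mul (hf : IsPoly f) (hg : IsPoly g) : IsPoly fun q => f q * g q := by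
  obtain ⟨p, hp⟩ := hf
  obtain ⟨p', hp'⟩ := hg
  exact ⟨p * p', fun q => by simp [hp, hp']⟩

lemma neg (hf : IsPoly f) : IsPoly fun q => -f q := by
  obtain ⟨p, hp⟩ := hf
  exact ⟨-p, fun q => by simp [hp]⟩

lemma sub (hf : IsPoly f) (hg : IsPoly g) : IsPoly fun q => f q - g q := by
  simpa only [sub_eq_add_neg] using hf.add hg.neg

lemma pow (hf : IsPoly f) (n : ℕ) : IsPoly fun q => f q ^ n := by
  obtain ⟨p, hp⟩ := hf
  exact ⟨p ^ n, fun q => by simp [hp]⟩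

lemma sum {ι : Type*} {s : Finset ι} {F : ι → Ambient d → ℂ} (h : ∀ a ∈ s, IsPoly (F a)) :
    IsPoly fun q => ∑ a ∈ s, F a q := by
  choose! p hp using h
  exact ⟨∑ a ∈ s, p a, fun q => by
    rw [map_sum]
    exact Finset.sum_congr rfl fun a ha => hp a ha q⟩

end IsPoly

/-- The coefficients of the family `F` of power series are polynomial functions. -/
def IsPolySeries (F : Ambient d → ℂ⟦X⟧) : Prop := ∀ k, IsPoly fun q => coeff k (F q)

namespace IsPolySeries

variable {F G : Ambient d → ℂ⟦X⟧}

lemma const (a : ℂ⟦X⟧) : IsPolySeries fun _ : Ambient d => a := fun _ => IsPoly.const _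

lemma scalar {f : Ambient d → ℂ} (hf : IsPoly f) : IsPolySeries fun q => C (f q) := fun k => by
  simp only [coeff_C]
  split_ifs
  exacts [hf, IsPoly.const 0]

lemma mul (hF : IsPolySeries F) (hG : IsPolySeries G) : IsPolySeries fun q => F q * G q :=
  fun k => by
    simp only [coeff_mul]
    exact IsPoly.sum fun a _ => (hF _).mul (hG _)

lemma add (hF : IsPolySeries F) (hG : IsPolySeries G) : IsPolySeries fun q => F q + G q :=
  fun k => by simpa only [map_add] using (hF k).add (hG k)

lemma sub (hF : IsPolySeries F) (hG : IsPolySeries G) : IsPolySeries fun q => F q - G q :=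
  fun k => by simpa only [map_sub] using (hF k).sub (hG k)

lemma neg (hF : IsPolySeries F) : IsPolySeries fun q => -F q :=
  fun k => by simpa only [map_neg] using (hF k).neg

lemma sum {ι : Type*} {s : Finset ι} {F : ι → Ambient d → ℂ⟦X⟧}
    (h : ∀ a ∈ s, IsPolySeries (F a)) : IsPolySeries fun q => ∑ a ∈ s, F a q := fun k => by
  simpa only [map_sum] using IsPoly.sum fun a ha => h a ha k

lemma base (i m : Fin 4) : IsPolySeries fun q : Ambient d => base i q m := by
  rcases Fin.eq_self_or_eq_succAbove i m with rfl | ⟨m, rfl⟩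
  · simpa using const (d := d) 1
  · simp only [LogJet.base, Fin.insertNth_apply_succAbove, div_eq_inv_mul]
    have h := fun k => IsPoly.coord (d := d) (Sum.inr (Sum.inl (m, k)))
    exact (((scalar (h 0)).add ((scalar (h 1)).mul (const _))).add
      ((scalar ((IsPoly.const _).mul (h 2))).mul (const _))).add
        ((scalar ((IsPoly.const _).mul (h 3))).mul (const _))

end IsPolySeries

lemma IsPoly.ratio (i j : Fin 4) : IsPoly fun q : Ambient d => ratio i j q := by
  simpa only [coeff_zero_eq_constantCoeff] using! IsPolySeries.base (d := d) i j 0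

lemma IsPoly.vec {i : Fin 4} {c : Ambient d → MultiIndex d → ℂ} {B : Ambient d → Fin 4 → ℂ⟦X⟧}
    {L : Ambient d → ℂ⟦X⟧} (hc : ∀ α, IsPoly fun q => c q α)
    (hB : ∀ m, IsPolySeries fun q => B q m) (hL : IsPolySeries L) (x : Coord d) :
    IsPoly fun q => vec i q (c q) (B q) (L q) x := by
  rcases x with α | ⟨m, k⟩ | k
  · exact hc α
  · exact (IsPoly.const _).mul (hB _ _)
  · refine Fin.cases ?_ (fun k => ?_) k
    · exact (IsPoly.coord (d := d) (Sum.inr (Sum.inr 0))).mul (hL _)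
    · exact (IsPoly.const _).mul (hL _)

lemma smul_vec (t : ℂ) (i : Fin 4) (q : Ambient d) (c : MultiIndex d → ℂ) (B : Fin 4 → ℂ⟦X⟧)
    (L : ℂ⟦X⟧) : t • vec i q c B L = vec i q (t • c) (fun m => C t * B m) (C t * L) := by
  funext x
  rcases x with α | ⟨m, k⟩ | k
  · rfl
  · simp only [vec, Pi.smul_apply, Sum.elim_inr, Sum.elim_inl, smul_eq_mul, coeff_C_mul]
    ring
  · refine Fin.cases ?_ (fun k => ?_) k
    · simp only [vec, Pi.smul_apply, Sum.elim_inr, Fin.cases_zero, smul_eq_mul, coeff_C_mul]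
      ring
    · simp only [vec, Pi.smul_apply, Sum.elim_inr, Fin.cases_succ, smul_eq_mul, coeff_C_mul]
      ring

/-! ### Fields induced by linear vector fields, and their gluing. -/

lemma mem_jets_iff {i : Fin 4} {q : Ambient d} :
    q ∈ jets d i ↔ (∃ α, param q α ≠ 0) ∧ trunc4 (equation i q) = 0 := by
  rw [← map_zero trunc4, trunc4_eq_iff]
  refine and_congr_right fun _ => ⟨fun h k hk => h ⟨k, hk⟩, fun h k => h k k.2⟩

lemma vec_mem_tangent_iff {i : Fin 4} {q : Ambient d} {c : MultiIndex d → ℂ}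
    {B : Fin 4 → ℂ⟦X⟧} (hB : B i = 0) {L : ℂ⟦X⟧} :
    vec i q c B L ∈ tangent i q ↔
      trunc4 (d * last q ^ d * L + MvPolynomial.aeval (base i q) (poly c) +
        ∑ m, MvPolynomial.aeval (base i q) (MvPolynomial.pderiv m (poly (param q))) * B m) = 0 := by
  have h := hasJetDeriv_equation i q c L hB
  rw [tangent, Submodule.mem_iInf, ← map_zero trunc4, trunc4_eq_iff]
  constructor
  · intro h' k hk
    rw [← (h k hk).2]
    exact h' ⟨k, hk⟩
  · intro h' k
    exact (h k k.2).2.trans (h' k k.2)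

/-- The linear vector field on `ℂ⁴` with matrix `A`. -/
noncomputable def lin (A : Matrix (Fin 4) (Fin 4) ℂ) (Z : Fin 4 → ℂ⟦X⟧) (m : Fin 4) : ℂ⟦X⟧ :=
  ∑ n, C (A m n) * Z n

lemma trunc4_lin (A : Matrix (Fin 4) (Fin 4) ℂ) {Z Z' : Fin 4 → ℂ⟦X⟧} {s : ℂ⟦X⟧}
    (h : ∀ m, trunc4 (Z' m) = trunc4 (Z m * s)) (m : Fin 4) :
    trunc4 (lin A Z' m) = trunc4 (lin A Z m) * trunc4 s := by
  simp only [lin, map_sum, map_mul, h, Finset.sum_mul, mul_assoc]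

/-- The vector on the chart `{Z_i ≠ 0}` induced by the linear vector field `A`, multiplied by `t`,
together with the variation `c` of the parameters. -/
noncomputable def linVec (A : Matrix (Fin 4) (Fin 4) ℂ) (t : ℂ) (i : Fin 4) (q : Ambient d)
    (c : MultiIndex d → ℂ) : Ambient d :=
  vec i q c (fun m => C t * (lin A (base i q) m - lin A (base i q) i * base i q m))
    (-(C t * lin A (base i q) i))

/-- Normalising `Z_i` to 1 subtracts a multiple of the Euler field in all five variables. By Euler's
identity this alters the derivative of the equation by a multiple of the equation itself, which
vanishes on jets. -/
lemma linVec_mem_tangent (A : Matrix (Fin 4) (Fin 4) ℂ) (t : ℂ) {i : Fin 4} {q : Ambient d}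
    {c : MultiIndex d → ℂ} (hq : q ∈ jets d i)
    (h : trunc4 (MvPolynomial.aeval (base i q) (poly c) + C t * ∑ m, MvPolynomial.aeval (base i q)
      (MvPolynomial.pderiv m (poly (param q))) * lin A (base i q) m) = 0) :
    linVec A t i q c ∈ tangent i q := by
  rw [linVec, vec_mem_tangent_iff (by simp)]
  have heq := (mem_jets_iff.1 hq).2
  rw [equation_eq] at heq
  have hE := congrArg (MvPolynomial.aeval (base i q)) (isHomogeneous_poly (param q)).sum_X_mul_pderiv
  simp only [map_sum, map_mul, MvPolynomial.aeval_X, map_nsmul] at hE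
  have key : d * last q ^ d * -(C t * lin A (base i q) i) +
      MvPolynomial.aeval (base i q) (poly c) +
      ∑ m, MvPolynomial.aeval (base i q) (MvPolynomial.pderiv m (poly (param q))) *
        (C t * (lin A (base i q) m - lin A (base i q) i * base i q m)) =
      (MvPolynomial.aeval (base i q) (poly c) + C t * ∑ m, MvPolynomial.aeval (base i q)
        (MvPolynomial.pderiv m (poly (param q))) * lin A (base i q) m) -
      C t * lin A (base i q) i * d *
        (last q ^ d + MvPolynomial.aeval (base i q) (poly (param q))) := by
    have : ∑ m, MvPolynomial.aeval (base i q) (MvPolynomial.pderiv m (poly (param q))) *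
        (C t * (lin A (base i q) m - lin A (base i q) i * base i q m)) =
        C t * ∑ m, MvPolynomial.aeval (base i q)
          (MvPolynomial.pderiv m (poly (param q))) * lin A (base i q) m -
        C t * lin A (base i q) i * ∑ m, base i q m * MvPolynomial.aeval (base i q)
          (MvPolynomial.pderiv m (poly (param q))) := by
      simp only [Finset.mul_sum, ← Finset.sum_sub_distrib]
      exact Finset.sum_congr rfl fun m _ => by ring
    rw [this, hE, nsmul_eq_mul]
    ring
  rw [key, map_sub, h, map_mul, heq, mul_zero, sub_zero]

/-- A linear field on the homogeneous coordinates induces one field on projective space, so its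
chart expressions agree; linearity absorbs the factor relating the two normalisations. -/
lemma fderiv_change_linVec (A : Matrix (Fin 4) (Fin 4) ℂ) (t : ℂ) {i j : Fin 4} {q : Ambient d}
    (h : ratio i j q ≠ 0) (c : MultiIndex d → ℂ) :
    fderiv ℂ (change i j) q (linVec A t i q c) = linVec A t j (change i j q) c := by
  rw [linVec, fderiv_change h _ (by simp), linVec]
  have hr : trunc4 (base i q j) * trunc4 (base i q j)⁻¹ = 1 := by
    rw [← map_mul, PowerSeries.mul_inv_cancel _ h, map_one]
  have hl := trunc4_lin A (fun m => base_change h m)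
  refine vec_congr (fun m => ?_) ?_
  · simp only [map_sub, map_mul, map_pow, hl, base_change h]
    linear_combination (trunc4 (C t) * trunc4 (lin A (base i q) i) * trunc4 (base i q m) *
      trunc4 (base i q j)⁻¹) * hr
  · simp only [map_sub, map_mul, map_neg, hl]
    linear_combination (trunc4 (C t) * trunc4 (lin A (base i q) i)) * hr

lemma smul_linVec (A : Matrix (Fin 4) (Fin 4) ℂ) (u t : ℂ) (i : Fin 4) (q : Ambient d)
    (c : MultiIndex d → ℂ) : u • linVec A t i q c = linVec A (u * t) i q (u • c) := by
  rw [linVec, smul_vec, linVec]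
  congr 1
  · funext m
    rw [map_mul]
    ring
  · rw [map_mul]
    ring

/-- Construction of global sections. -/
lemma exists_twistedField (A : Matrix (Fin 4) (Fin 4) ℂ) (l : Fin 4)
    (c : Fin 4 → Ambient d → MultiIndex d → ℂ) (hc : ∀ i α, IsPoly fun q => c i q α)
    (htan : ∀ i, ∀ q ∈ jets d i, trunc4 (MvPolynomial.aeval (base i q) (poly (c i q)) +
      C (ratio i l q ^ 12) * ∑ m, MvPolynomial.aeval (base i q)
        (MvPolynomial.pderiv m (poly (param q))) * lin A (base i q) m) = 0)
    (hglue : ∀ i j q, ratio i j q ≠ 0 → c i q = ratio i j q ^ 12 • c j (change i j q)) :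
    ∃ s : TwistedField d 12, ∀ i q, s.value i q = linVec A (ratio i l q ^ 12) i q (c i q) := by
  have hpoly : ∀ i x, IsPoly fun q => linVec A (ratio i l q ^ 12) i q (c i q) x := by
    intro i x
    have hlin : ∀ m, IsPolySeries fun q : Ambient d => lin A (base i q) m := fun m =>
      IsPolySeries.sum fun n _ => (IsPolySeries.const _).mul (IsPolySeries.base i n)
    have ht := IsPolySeries.scalar ((IsPoly.ratio (d := d) i l).pow 12)
    exact IsPoly.vec (hc i)
      (fun m => ht.mul ((hlin m).sub ((hlin i).mul (IsPolySeries.base i m))))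
      (ht.mul (hlin i)).neg x
  choose p hp using hpoly
  have hval : ∀ i q, (fun x => MvPolynomial.eval q (p i x)) =
      linVec A (ratio i l q ^ 12) i q (c i q) := fun i q => funext fun x => hp i x q
  refine ⟨⟨p, fun i q hq => ?_, fun i j q _ h => ?_⟩, hval⟩
  · rw [hval]
    exact linVec_mem_tangent A _ hq (htan i q hq)
  · rw [hval, hval, fderiv_change_linVec A _ h, smul_linVec, ← hglue i j q h, ratio_change h,
      ← mul_pow, mul_comm (ratio i l q), mul_inv_cancel_left₀ h]

/-- The coefficients of the family `F` of polynomials are polynomial functions. -/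
def IsPolyMv (F : Ambient d → MvPolynomial (Fin 4) ℂ) : Prop :=
  ∀ β, IsPoly fun q => MvPolynomial.coeff β (F q)

namespace IsPolyMv

variable {F G : Ambient d → MvPolynomial (Fin 4) ℂ}

lemma const (P : MvPolynomial (Fin 4) ℂ) : IsPolyMv fun _ : Ambient d => P :=
  fun _ => IsPoly.const _

lemma scalar {f : Ambient d → ℂ} (hf : IsPoly f) : IsPolyMv fun q => MvPolynomial.C (f q) :=
  fun β => by
    classical
    simp only [MvPolynomial.coeff_C]
    split_ifs
    exacts [hf, IsPoly.const 0]

lemma mul (hF : IsPolyMv F) (hG : IsPolyMv G) : IsPolyMv fun q => F q * G q := fun β => by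
  classical
  simp only [MvPolynomial.coeff_mul]
  exact IsPoly.sum fun a _ => (hF _).mul (hG _)

lemma sub (hF : IsPolyMv F) (hG : IsPolyMv G) : IsPolyMv fun q => F q - G q := fun β => by
  simpa only [MvPolynomial.coeff_sub] using (hF β).sub (hG β)

lemma sum {ι : Type*} {s : Finset ι} {F : ι → Ambient d → MvPolynomial (Fin 4) ℂ}
    (h : ∀ a ∈ s, IsPolyMv (F a)) : IsPolyMv fun q => ∑ a ∈ s, F a q := fun β => by
  simpa only [MvPolynomial.coeff_sum] using IsPoly.sum fun a ha => h a ha β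

lemma pderiv_poly (m : Fin 4) :
    IsPolyMv fun q : Ambient d => MvPolynomial.pderiv m (poly (param q)) := by
  have h : ∀ q : Ambient d, MvPolynomial.pderiv m (poly (param q)) =
      ∑ α, MvPolynomial.C (q (Sum.inl α)) *
        MvPolynomial.pderiv m (MvPolynomial.monomial (expo α) (1 : ℂ)) := by
    intro q
    rw [poly, map_sum]
    refine Finset.sum_congr rfl fun α _ => ?_
    rw [← MvPolynomial.pderiv_C_mul, MvPolynomial.C_mul_monomial, mul_one]
    rfl
  simp only [h]
  exact sum fun α _ => (scalar (IsPoly.coord _)).mul (const _)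

end IsPolyMv

/-! ### Sections from the action of `𝔤𝔩₄`. -/

/-- The linear form with coefficient vector `v`. -/
noncomputable def linForm (v : Fin 4 → ℂ) : MvPolynomial (Fin 4) ℂ :=
  ∑ m, MvPolynomial.C (v m) * MvPolynomial.X m

lemma isHomogeneous_linForm (v : Fin 4 → ℂ) : (linForm v).IsHomogeneous 1 :=
  MvPolynomial.IsHomogeneous.sum _ _ _ fun _ _ => MvPolynomial.isHomogeneous_C_mul_X _ _

lemma linForm_smul (t : ℂ) (v : Fin 4 → ℂ) : linForm (t • v) = MvPolynomial.C t * linForm v := by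
  simp [linForm, Finset.mul_sum, mul_assoc]

lemma aeval_linForm (v : Fin 4 → ℂ) (Z : Fin 4 → ℂ⟦X⟧) :
    MvPolynomial.aeval Z (linForm v) = ∑ m, C (v m) * Z m := by
  simp only [linForm, map_sum, map_mul, MvPolynomial.aeval_X, MvPolynomial.aeval_C]
  rfl

lemma IsPolyMv.linForm {v : Ambient d → Fin 4 → ℂ} (h : ∀ m, IsPoly fun q => v q m) :
    IsPolyMv fun q => linForm (v q) :=
  sum fun m _ => (scalar (h m)).mul (const _)

lemma coeffs_C_mul (t : ℂ) (P : MvPolynomial (Fin 4) ℂ) :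
    coeffs d (MvPolynomial.C t * P) = t • coeffs d P := by
  funext α
  simp [coeffs]

lemma aeval_C_mul (t : ℂ) (P : MvPolynomial (Fin 4) ℂ) (Z : Fin 4 → ℂ⟦X⟧) :
    MvPolynomial.aeval Z (MvPolynomial.C t * P) = C t * MvPolynomial.aeval Z P := by
  rw [map_mul, MvPolynomial.aeval_C]
  rfl

/-- The action of the linear vector field `A` on forms of degree `d`, up to sign. -/
noncomputable def linAct (A : Matrix (Fin 4) (Fin 4) ℂ) (P : MvPolynomial (Fin 4) ℂ) :
    MvPolynomial (Fin 4) ℂ :=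
  ∑ m, linForm (A m) * MvPolynomial.pderiv m P

lemma isHomogeneous_linAct (hd : 1 ≤ d) (A : Matrix (Fin 4) (Fin 4) ℂ)
    {P : MvPolynomial (Fin 4) ℂ} (hP : P.IsHomogeneous d) : (linAct A P).IsHomogeneous d := by
  refine MvPolynomial.IsHomogeneous.sum _ _ _ fun m _ => ?_
  have := (isHomogeneous_linForm (A m)).mul (hP.pderiv (i := m))
  rwa [Nat.add_sub_cancel' hd] at this

/-- The sections given by the action of `𝔤𝔩₄` on `Z₀, …, Z₃`. -/
lemma exists_linear_twistedField (hd : 1 ≤ d) (A : Matrix (Fin 4) (Fin 4) ℂ) (l : Fin 4) :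
    ∃ s : TwistedField d 12, ∀ q, ∃ c, s.value l q = linVec A 1 l q c := by
  obtain ⟨s, hs⟩ := exists_twistedField A l
    (fun i q => coeffs d (MvPolynomial.C (-ratio i l q ^ 12) * linAct A (poly (param q))))
    (fun i α => (IsPolyMv.scalar ((IsPoly.ratio i l).pow 12).neg).mul
      (IsPolyMv.sum fun m _ => (IsPolyMv.const _).mul (IsPolyMv.pderiv_poly m)) _)
    (fun i q _ => by
      rw [poly_coeffs ((isHomogeneous_linAct hd A (isHomogeneous_poly (param q))).C_mul _),
        aeval_C_mul, linAct, map_sum]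
      have : ∀ m, MvPolynomial.aeval (base i q)
          (linForm (A m) * MvPolynomial.pderiv m (poly (param q))) = MvPolynomial.aeval (base i q)
          (MvPolynomial.pderiv m (poly (param q))) * lin A (base i q) m := fun m => by
        rw [map_mul, aeval_linForm, mul_comm]
        rfl
      simp only [this, map_neg, neg_mul, neg_add_cancel, map_zero])
    (fun i j q h => by
      rw [coeffs_C_mul, coeffs_C_mul, smul_smul, param_change, ratio_change h]
      congr 1
      field_simp)
  refine ⟨s, fun q =>
    ⟨coeffs d (MvPolynomial.C (-ratio l l q ^ 12) * linAct A (poly (param q))), ?_⟩⟩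
  rw [hs]
  simp [ratio]

/-! ### Linear forms and quadrics adapted to a jet. -/

/-- The matrix of the coefficients of order `≤ 3` of four power series. -/
noncomputable def coefMat (Z : Fin 4 → ℂ⟦X⟧) : Matrix (Fin 4) (Fin 4) ℂ :=
  Matrix.of fun m k => coeff (k : ℕ) (Z m)

/-- The Toeplitz matrix of multiplication by a power series modulo `X ^ 4`. -/
noncomputable def shiftMat (F : ℂ⟦X⟧) : Matrix (Fin 4) (Fin 4) ℂ :=
  coefMat fun k => X ^ (k : ℕ) * F

lemma coefMat_congr {Z Z' : Fin 4 → ℂ⟦X⟧} (h : ∀ m, trunc4 (Z m) = trunc4 (Z' m)) :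
    coefMat Z = coefMat Z' := by
  ext m k
  exact coeff_eq_of_trunc4 (h m) k.2

lemma shiftMat_congr {F F' : ℂ⟦X⟧} (h : trunc4 F = trunc4 F') : shiftMat F = shiftMat F' :=
  coefMat_congr fun m => by rw [map_mul, map_mul, h]

lemma coefMat_mul (Z : Fin 4 → ℂ⟦X⟧) (F : ℂ⟦X⟧) :
    coefMat (fun m => Z m * F) = coefMat Z * shiftMat F := by
  ext m k
  simp only [coefMat, shiftMat, Matrix.mul_apply, Matrix.of_apply, Fin.sum_univ_four]
  obtain ⟨h0, h1, h2, h3⟩ := coeff_mul_of_lt_four (Z m) F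
  fin_cases k <;> simp [h0, h1, h2, h3, coeff_X_pow_mul']

lemma shiftMat_mul (F G : ℂ⟦X⟧) : shiftMat (F * G) = shiftMat F * shiftMat G := by
  rw [shiftMat, shiftMat, ← coefMat_mul]
  simp only [mul_assoc]

lemma det_shiftMat (F : ℂ⟦X⟧) : (shiftMat F).det = constantCoeff F ^ 4 := by
  rw [Matrix.det_of_isUpperTriangular]
  · simp [shiftMat, coefMat, coeff_X_pow_mul']
  · intro i j hij
    have : j < i := hij
    simp [shiftMat, coefMat, coeff_X_pow_mul', this]

/-- The coefficient vectors of four linear forms; the `k`-th one takes the value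
`det (coefMat Z) * X ^ k * F` modulo `X ^ 4` at `Z`. -/
noncomputable def flag (Z : Fin 4 → ℂ⟦X⟧) (F : ℂ⟦X⟧) : Matrix (Fin 4) (Fin 4) ℂ :=
  shiftMat F * (coefMat Z).adjugate

lemma trunc4_aeval_flag (Z : Fin 4 → ℂ⟦X⟧) (F : ℂ⟦X⟧) (k : Fin 4) :
    trunc4 (MvPolynomial.aeval Z (linForm (flag Z F k))) =
      trunc4 (C (coefMat Z).det * (X ^ (k : ℕ) * F)) := by
  rw [trunc4_eq_iff]
  intro l hl
  lift l to Fin 4 using hl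
  have h : flag Z F * coefMat Z = (coefMat Z).det • shiftMat F := by
    rw [flag, Matrix.mul_assoc, Matrix.adjugate_mul, Matrix.mul_smul, Matrix.mul_one]
  have := congrFun (congrFun h k) l
  rw [Matrix.mul_apply] at this
  rw [aeval_linForm, map_sum, coeff_C_mul]
  simp only [coeff_C_mul]
  exact this

/-- Scaling `F` along with `Z` is what makes the answer a scalar: the Toeplitz matrix of `s` meets
its own adjugate, leaving only its determinant. With `F` fixed, a triangular matrix would survive.
-/
lemma flag_mul (Z : Fin 4 → ℂ⟦X⟧) (F s : ℂ⟦X⟧) :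
    flag (fun m => Z m * s) (F * s) = constantCoeff s ^ 4 • flag Z F := by
  rw [flag, coefMat_mul, Matrix.adjugate_mul_distrib, shiftMat_mul, Matrix.mul_assoc,
    ← Matrix.mul_assoc (shiftMat s), Matrix.mul_adjugate, det_shiftMat, Matrix.smul_mul,
    Matrix.one_mul, Matrix.mul_smul]
  rfl

lemma flag_congr {Z Z' : Fin 4 → ℂ⟦X⟧} (h : ∀ m, trunc4 (Z m) = trunc4 (Z' m)) {F F' : ℂ⟦X⟧}
    (hF : trunc4 F = trunc4 F') : flag Z F = flag Z' F' := by
  rw [flag, flag, coefMat_congr h, shiftMat_congr hF]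

lemma IsPoly.adjugate {M : Ambient d → Matrix (Fin 4) (Fin 4) ℂ}
    (hM : ∀ m k, IsPoly fun q => M q m k) (m k : Fin 4) :
    IsPoly fun q => (M q).adjugate m k := by
  choose p hp using hM
  refine ⟨(Matrix.of p).adjugate m k, fun q => ?_⟩
  have h := (MvPolynomial.eval q).map_adjugate (Matrix.of p)
  rw [show (MvPolynomial.eval q).mapMatrix (Matrix.of p) = M q from
    Matrix.ext fun a b => hp a b q] at h
  exact congrFun (congrFun h m) k

lemma IsPoly.flag (i l k m : Fin 4) :
    IsPoly fun q : Ambient d => flag (base i q) (base i q l) k m := by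
  have hs : ∀ a, IsPoly fun q : Ambient d => shiftMat (base i q l) k a := fun a =>
    ((IsPolySeries.const (X ^ (k : ℕ))).mul (IsPolySeries.base i l)) a
  have hadj : ∀ a, IsPoly fun q : Ambient d => (coefMat (base i q)).adjugate a m := fun a =>
    IsPoly.adjugate (fun m k => IsPolySeries.base i m k) a m
  simp only [LogJet.flag, Matrix.mul_apply]
  exact IsPoly.sum fun a _ => (hs a).mul (hadj a)

/-- The quadric `ℓ_a ℓ_b - ℓ_0 ℓ_{a+b}`, where `ℓ_k = 0` for `k ≥ 4`, attached to the linear forms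
with coefficient vectors the rows of `N`. -/
noncomputable def quadric (N : Matrix (Fin 4) (Fin 4) ℂ) (a b : Fin 4) : MvPolynomial (Fin 4) ℂ :=
  linForm (N a) * linForm (N b) -
    if h : (a : ℕ) + b < 4 then linForm (N 0) * linForm (N ⟨a + b, h⟩) else 0

lemma isHomogeneous_quadric (N : Matrix (Fin 4) (Fin 4) ℂ) (a b : Fin 4) :
    (quadric N a b).IsHomogeneous 2 := by
  refine ((isHomogeneous_linForm _).mul (isHomogeneous_linForm _)).sub ?_
  split_ifs
  · exact (isHomogeneous_linForm _).mul (isHomogeneous_linForm _)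
  · exact MvPolynomial.isHomogeneous_zero _ _ _

lemma quadric_smul (t : ℂ) (N : Matrix (Fin 4) (Fin 4) ℂ) (a b : Fin 4) :
    quadric (t • N) a b = MvPolynomial.C (t ^ 2) * quadric N a b := by
  have h : ∀ k, linForm ((t • N) k) = MvPolynomial.C t * linForm (N k) := fun k =>
    linForm_smul t (N k)
  simp only [quadric, h, map_pow]
  split_ifs <;> ring

/-- Along the jet `ℓ_k` is a common factor times `t ^ k`, so this is `t ^ a * t ^ b = t ^ (a + b)`,
with the right side zero from order 4 on. -/
lemma trunc4_aeval_quadric (Z : Fin 4 → ℂ⟦X⟧) (F : ℂ⟦X⟧) (a b : Fin 4) :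
    trunc4 (MvPolynomial.aeval Z (quadric (flag Z F) a b)) = 0 := by
  rw [quadric]
  split_ifs with h
  · simp only [map_sub, map_mul, trunc4_aeval_flag]
    simp only [← map_mul, ← map_sub]
    rw [← map_zero trunc4]
    congr 1
    rw [Fin.val_zero]
    ring
  · rw [sub_zero, map_mul, map_mul, trunc4_aeval_flag, trunc4_aeval_flag, ← map_mul,
      show ∀ u : ℂ⟦X⟧, u * (X ^ (a : ℕ) * F) * (u * (X ^ (b : ℕ) * F)) =
        X ^ ((a : ℕ) + b) * (u ^ 2 * F ^ 2) from fun u => by ring, map_mul,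
      trunc4_X_pow (by omega), zero_mul]

lemma IsPolyMv.quadric (i l a b : Fin 4) :
    IsPolyMv fun q : Ambient d => quadric (flag (base i q) (base i q l)) a b := by
  have h : ∀ k, IsPolyMv fun q : Ambient d =>
      LogJet.linForm (LogJet.flag (base i q) (base i q l) k) := fun k =>
    IsPolyMv.linForm fun m => IsPoly.flag i l k m
  simp only [LogJet.quadric]
  split_ifs
  · exact ((h a).mul (h b)).sub ((h _).mul (h _))
  · exact ((h a).mul (h b)).sub (const 0)

/-- The sections along the parameters, given by the forms vanishing on the osculating jet. -/
lemma exists_param_twistedField (l a b : Fin 4) {e : ℕ} (he : 2 + e = d)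
    {R : MvPolynomial (Fin 4) ℂ} (hR : R.IsHomogeneous e) :
    ∃ s : TwistedField d 12, ∀ q, s.value l q =
      vec l q (coeffs d (quadric (flag (base l q) 1) a b * R)) 0 0 := by
  have hlin : ∀ Z m, lin 0 Z m = 0 := by simp [lin]
  obtain ⟨s, hs⟩ := exists_twistedField (d := d) 0 l
    -- The quadric has weight 8, being quadratic in forms of weight 4; the factor `(Z_l / Z_i) ^ 4`
    -- raises the weight to 12. In the chart `l` this factor and the series `F` both equal 1.
    (fun i q => coeffs d (MvPolynomial.C (ratio i l q ^ 4) *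
      (quadric (flag (base i q) (base i q l)) a b * R)))
    (fun i α => (IsPolyMv.scalar ((IsPoly.ratio i l).pow 4)).mul
      ((IsPolyMv.quadric i l a b).mul (IsPolyMv.const R)) _)
    (fun i q _ => by
      rw [poly_coeffs]
      · simp only [hlin, mul_zero, Finset.sum_const_zero, add_zero]
        rw [aeval_C_mul, map_mul, map_mul, map_mul, trunc4_aeval_quadric, zero_mul, mul_zero]
      · have := (isHomogeneous_quadric (flag (base i q) (base i q l)) a b).mul hR
        rw [he] at this
        exact this.C_mul _)
    (fun i j q h => by
      have hf : flag (base j (change i j q)) (base j (change i j q) l) =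
          (ratio i j q)⁻¹ ^ 4 • flag (base i q) (base i q l) := by
        rw [flag_congr (base_change h) (base_change h l), flag_mul, constantCoeff_inv]
        rfl
      rw [hf, quadric_smul, mul_assoc (MvPolynomial.C (_ ^ 2)), coeffs_C_mul, coeffs_C_mul,
        coeffs_C_mul, smul_smul, smul_smul, ratio_change h]
      congr 1
      field_simp)
  refine ⟨s, fun q => ?_⟩
  rw [hs, linVec]
  simp only [hlin, ratio, base_self, map_one, one_pow, one_mul, mul_zero, zero_mul, sub_zero,
    neg_zero]
  rfl

/-! ### Forms vanishing along a nondegenerate jet. -/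

/-- The forms of degree `n` in the ideal generated by the quadrics of `N`. -/
noncomputable def quadSpan (N : Matrix (Fin 4) (Fin 4) ℂ) (n : ℕ) :
    Submodule ℂ (MvPolynomial (Fin 4) ℂ) :=
  Submodule.span ℂ {P | ∃ (a b : Fin 4) (e : ℕ) (R : MvPolynomial (Fin 4) ℂ),
    2 + e = n ∧ R.IsHomogeneous e ∧ P = quadric N a b * R}

lemma quadric_mul_mem_quadSpan (N : Matrix (Fin 4) (Fin 4) ℂ) (a b : Fin 4) {n e : ℕ}
    (he : 2 + e = n) {R : MvPolynomial (Fin 4) ℂ} (hR : R.IsHomogeneous e) :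
    quadric N a b * R ∈ quadSpan N n :=
  Submodule.subset_span ⟨a, b, e, R, he, hR, rfl⟩

lemma homogeneousSubmodule_one_le {N : Matrix (Fin 4) (Fin 4) ℂ} (hN : N.det ≠ 0) :
    MvPolynomial.homogeneousSubmodule (Fin 4) ℂ 1 ≤
      Submodule.span ℂ (Set.range fun k => linForm (N k)) := by
  rw [MvPolynomial.homogeneousSubmodule_one_eq_span_X, Submodule.span_le]
  rintro _ ⟨m, rfl⟩
  have hX : (MvPolynomial.X m : MvPolynomial (Fin 4) ℂ) = ∑ k, N⁻¹ m k • linForm (N k) := by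
    have h : N⁻¹ * N = 1 := Matrix.nonsing_inv_mul N (isUnit_iff_ne_zero.2 hN)
    have hm : ∀ n, ∑ k, N⁻¹ m k * N k n = (1 : Matrix (Fin 4) (Fin 4) ℂ) m n := fun n => by
      rw [← h, Matrix.mul_apply]
    simp only [linForm, Finset.smul_sum, MvPolynomial.smul_eq_C_mul, ← mul_assoc, ← map_mul]
    rw [Finset.sum_comm]
    simp only [← Finset.sum_mul, ← map_sum, hm, Matrix.one_apply]
    simp
  rw [SetLike.mem_coe, hX]
  exact Submodule.sum_mem _ fun k _ => Submodule.smul_mem _ _ (Submodule.subset_span ⟨k, rfl⟩)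

/-- Modulo the quadrics of `N`, every form of degree `e + 1` is divisible by `ℓ₀ ^ e`. -/
lemma homogeneousSubmodule_le {N : Matrix (Fin 4) (Fin 4) ℂ} (hN : N.det ≠ 0) (e : ℕ) :
    MvPolynomial.homogeneousSubmodule (Fin 4) ℂ (e + 1) ≤ quadSpan N (e + 1) ⊔
      Submodule.span ℂ (Set.range fun k => linForm (N 0) ^ e * linForm (N k)) := by
  induction e with
  | zero =>
    simpa using (homogeneousSubmodule_one_le hN).trans le_sup_right
  | succ e ih =>
    rw [← MvPolynomial.homogeneousSubmodule_one_pow, pow_succ,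
      MvPolynomial.homogeneousSubmodule_one_pow]
    refine (mul_le_mul' ih (homogeneousSubmodule_one_le hN)).trans ?_
    rw [Submodule.sup_mul, quadSpan, Submodule.span_mul_span, Submodule.span_mul_span, sup_le_iff]
    constructor <;> rw [Submodule.span_le]
    · rintro _ ⟨_, ⟨a, b, f, R, hf, hR, rfl⟩, _, ⟨k, rfl⟩, rfl⟩
      simp only [mul_assoc]
      exact Submodule.mem_sup_left (quadric_mul_mem_quadSpan N a b (by omega)
        (hR.mul (isHomogeneous_linForm _)))
    · rintro _ ⟨_, ⟨a, rfl⟩, _, ⟨b, rfl⟩, rfl⟩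
      have hR : (linForm (N 0) ^ e).IsHomogeneous e := by
        simpa using (isHomogeneous_linForm (N 0)).pow e
      have hdec : linForm (N 0) ^ e * linForm (N a) * linForm (N b) =
          quadric N a b * linForm (N 0) ^ e + linForm (N 0) ^ e *
            (if h : (a : ℕ) + b < 4 then linForm (N 0) * linForm (N ⟨a + b, h⟩) else 0) := by
        rw [quadric]
        ring
      simp only [SetLike.mem_coe]
      rw [hdec]
      refine Submodule.add_mem_sup (quadric_mul_mem_quadSpan N a b (by omega) hR) ?_
      split_ifs with h
      · rw [← mul_assoc, ← pow_succ]
        exact Submodule.subset_span ⟨_, rfl⟩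
      · simp

lemma det_flag_one_ne_zero {Z : Fin 4 → ℂ⟦X⟧} (hZ : (coefMat Z).det ≠ 0) :
    (flag Z 1).det ≠ 0 := by
  rw [flag, Matrix.det_mul, det_shiftMat, Matrix.det_adjugate]
  simpa using hZ

/-- The forms vanishing to order `3` along a nondegenerate jet. -/
lemma mem_quadSpan {Z : Fin 4 → ℂ⟦X⟧} (hZ : (coefMat Z).det ≠ 0) (hd : 1 ≤ d)
    {P : MvPolynomial (Fin 4) ℂ} (hP : P.IsHomogeneous d)
    (h0 : trunc4 (MvPolynomial.aeval Z P) = 0) : P ∈ quadSpan (flag Z 1) d := by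
  obtain ⟨e, rfl⟩ : ∃ e, d = e + 1 := ⟨d - 1, by omega⟩
  obtain ⟨S, hS, T, hT, rfl⟩ := Submodule.mem_sup.1
    (homogeneousSubmodule_le (det_flag_one_ne_zero hZ) e hP)
  obtain ⟨c, rfl⟩ := (Submodule.mem_span_range_iff_exists_fun ℂ).1 hT
  have hS0 : trunc4 (MvPolynomial.aeval Z S) = 0 := by
    have hle : quadSpan (flag Z 1) (e + 1) ≤
        LinearMap.ker (trunc4.comp (MvPolynomial.aeval Z)).toLinearMap := by
      rw [quadSpan, Submodule.span_le]
      rintro _ ⟨a, b, f, R, -, -, rfl⟩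
      change trunc4 (MvPolynomial.aeval Z _) = 0
      rw [map_mul, map_mul, trunc4_aeval_quadric, zero_mul]
    exact hle hS
  suffices hc : ∀ k, c k = 0 by simpa [hc] using hS
  rw [map_add, map_add, hS0, zero_add] at h0
  -- Modulo the quadrics only the combination of the `ℓ_0 ^ e * ℓ_k` remains; its values are
  -- multiples of distinct powers of `t` below 4, hence independent.
  have hval : trunc4 (∑ k : Fin 4, C (c k * (coefMat Z).det ^ (e + 1)) * X ^ (k : ℕ)) = 0 := by
    rw [← h0]
    simp only [map_sum, map_mul, MvPolynomial.smul_eq_C_mul, map_pow, trunc4_aeval_flag,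
      MvPolynomial.aeval_C, Fin.val_zero, pow_zero, mul_one,
      show ∀ a : ℂ, algebraMap ℂ ℂ⟦X⟧ a = C a from fun _ => rfl]
    exact Finset.sum_congr rfl fun k _ => by ring
  rw [← map_zero trunc4, trunc4_eq_iff] at hval
  intro k
  have := hval k k.2
  simp only [map_sum, coeff_C_mul, coeff_X_pow, Fin.val_inj] at this
  simpa [hZ] using this

/-! ### Spanning the tangent space. -/

/-- The values of the sections span all tangent directions along the parameters. -/
lemma vec_param_mem_span (hd : 1 ≤ d) {i : Fin 4} {q : Ambient d}
    (hW : (coefMat (base i q)).det ≠ 0) {c : MultiIndex d → ℂ} (h : vec i q c 0 0 ∈ tangent i q) :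
    vec i q c 0 0 ∈ Submodule.span ℂ (Set.range fun s : TwistedField d 12 => s.value i q) := by
  rw [vec_mem_tangent_iff rfl] at h
  simp only [mul_zero, zero_add, Pi.zero_apply, Finset.sum_const_zero, add_zero] at h
  rw [← coeffs_poly c]
  refine Submodule.span_induction
    (p := fun P _ => vec i q (coeffs d P) 0 0 ∈
      Submodule.span ℂ (Set.range fun s : TwistedField d 12 => s.value i q))
    ?_ ?_ ?_ ?_ (mem_quadSpan hW hd (isHomogeneous_poly c) h)
  · rintro _ ⟨a, b, e, R, he, hR, rfl⟩
    obtain ⟨s, hs⟩ := exists_param_twistedField i a b he hR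
    exact Submodule.subset_span ⟨s, hs q⟩
  · convert Submodule.zero_mem _
    funext x
    rcases x with α | ⟨m, k⟩ | k
    · simp [vec, coeffs]
    · simp [vec]
    · refine Fin.cases ?_ (fun k => ?_) k <;> simp [vec]
  · intro P Q _ _ hP hQ
    convert Submodule.add_mem _ hP hQ
    funext x
    rcases x with α | ⟨m, k⟩ | k
    · simp [vec, coeffs]
    · simp [vec]
    · refine Fin.cases ?_ (fun k => ?_) k <;> simp [vec]
  · intro t P _ hP
    convert Submodule.smul_mem _ t hP using 1
    rw [smul_vec, MvPolynomial.smul_eq_C_mul, coeffs_C_mul]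
    simp only [Pi.zero_apply, mul_zero]
    rfl

lemma exists_lin_eq {Z : Fin 4 → ℂ⟦X⟧} (hZ : (coefMat Z).det ≠ 0) (Y : Fin 4 → ℂ⟦X⟧) :
    ∃ A, ∀ m, trunc4 (lin A Z m) = trunc4 (Y m) := by
  refine ⟨coefMat Y * (coefMat Z)⁻¹, fun m => ?_⟩
  rw [trunc4_eq_iff]
  intro k hk
  lift k to Fin 4 using hk
  have h : coefMat Y * (coefMat Z)⁻¹ * coefMat Z = coefMat Y := by
    rw [Matrix.mul_assoc, Matrix.nonsing_inv_mul _ (isUnit_iff_ne_zero.2 hZ), Matrix.mul_one]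
  have hm := congrFun (congrFun h m) k
  rw [Matrix.mul_apply] at hm
  rw [lin, map_sum]
  simp only [coeff_C_mul]
  exact hm

/-- The boundary is excluded because the constant term of `L` is the variation of `z₄` divided by
`z₄`. -/
lemma exists_eq_vec {i : Fin 4} {q : Ambient d} (hq : xi4 q 0 ≠ 0) (v : Ambient d) :
    ∃ c B L, B i = 0 ∧ v = vec i q c B L := by
  refine ⟨param v, fun m => if m = i then 0 else base i v m, PowerSeries.mk fun k =>
    if h : k < 4 then Fin.cases (xi4 v 0 / xi4 q 0)
      (fun k : Fin 3 => xi4 v k.succ / (((k : ℕ) + 1).factorial : ℂ)) (⟨k, h⟩ : Fin 4) else 0,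
    by simp, ?_⟩
  have hf : ∀ n : ℕ, (n.factorial : ℂ) ≠ 0 := fun n => Nat.cast_ne_zero.2 n.factorial_ne_zero
  funext x
  rcases x with α | ⟨m, k⟩ | k
  · rfl
  · simp only [vec, Sum.elim_inr, Sum.elim_inl, if_neg (Fin.succAbove_ne i m), coeff_base]
    rw [mul_div_cancel₀ _ (hf _)]
    rfl
  · refine Fin.cases ?_ (fun k => ?_) k
    · simp only [vec, Sum.elim_inr, Fin.cases_zero, coeff_mk]
      exact (mul_div_cancel₀ _ hq).symm
    · simp only [vec, Sum.elim_inr, Fin.cases_succ, coeff_mk]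
      rw [dif_pos (by omega)]
      exact (mul_div_cancel₀ _ (hf _)).symm

/-- Off the Wronskian locus and the boundary, the values of the sections span the tangent space. -/
lemma tangent_le_span (hd : 1 ≤ d) {i : Fin 4} {q : Ambient d} (hq : q ∈ jets d i)
    (hW : (coefMat (base i q)).det ≠ 0) (hH : xi4 q 0 ≠ 0) :
    tangent i q ≤ Submodule.span ℂ (Set.range fun s : TwistedField d 12 => s.value i q) := by
  intro v hv
  obtain ⟨c, B, L, hB, rfl⟩ := exists_eq_vec (i := i) hH v
  -- Since `B i = 0`, the `i`-th component of the linear field is `-L`; renormalising `Z_i` to 1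
  -- therefore produces exactly `B` and `L`.
  obtain ⟨A, hA⟩ := exists_lin_eq hW fun m => B m - L * base i q m
  obtain ⟨s, hs⟩ := exists_linear_twistedField hd A i
  obtain ⟨c', hc'⟩ := hs q
  have hval : s.value i q = vec i q c' B L := by
    rw [hc', linVec]
    refine vec_congr (fun m => ?_) ?_
    · simp only [map_sub, map_mul, map_one, hA, hB, base_self, map_zero]
      ring
    · simp only [map_neg, map_mul, map_one, hA, hB, base_self, map_sub, map_zero]
      ring
  have hdiff : vec i q c B L - s.value i q = vec i q (c - c') 0 0 := by
    rw [hval]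
    funext x
    rcases x with α | ⟨m, k⟩ | k
    · simp [vec]
    · simp [vec]
    · refine Fin.cases ?_ (fun k => ?_) k <;> simp [vec]
  have hs_mem : s.value i q ∈
      Submodule.span ℂ (Set.range fun s : TwistedField d 12 => s.value i q) :=
    Submodule.subset_span ⟨s, rfl⟩
  rw [← sub_add_cancel (vec i q c B L) (s.value i q)]
  refine Submodule.add_mem _ ?_ hs_mem
  have := Submodule.sub_mem _ hv (s.tangent_mem i q hq)
  change vec i q c B L - s.value i q ∈ _ at this
  rw [hdiff] at this ⊢
  exact vec_param_mem_span hd hW this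

/-! ### The Wronskian locus and its closure. -/

/-- The row of `Z_0 / Z_0 = 1` reduces the determinant to size 3, and `12 = 1! * 2! * 3!` clears the
Taylor denominators. -/
lemma det_xi_eq (q : Ambient d) :
    (Matrix.of fun m k : Fin 3 => xi q m k.succ).det = 12 * (coefMat (base 0 q)).det := by
  have h : ∀ m k : Fin 3, coeff ((k : ℕ) + 1) (base 0 q m.succ) =
      xi q m k.succ / (((k : ℕ) + 1).factorial : ℂ) := fun m k => by
    simpa using coeff_base 0 q m k.succ
  have hsub : (coefMat (base 0 q)).submatrix Fin.succ (Fin.succAbove 0) =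
      Matrix.of fun m k : Fin 3 => xi q m k.succ / (((k : ℕ) + 1).factorial : ℂ) := by
    ext m k
    exact h m k
  rw [Matrix.det_succ_row_zero (coefMat (base 0 q)), Fin.sum_univ_succ, hsub]
  simp only [coefMat, Matrix.of_apply, base_self, coeff_one, Fin.val_succ, Nat.succ_ne_zero,
    if_false, mul_zero, zero_mul, Finset.sum_const_zero, Matrix.det_fin_three]
  norm_num [Nat.factorial]
  ring

lemma det_coefMat_change {i j : Fin 4} {q : Ambient d} (h : ratio i j q ≠ 0) :
    (coefMat (base j (change i j q))).det =
      (coefMat (base i q)).det * (ratio i j q)⁻¹ ^ 4 := by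
  rw [coefMat_congr (base_change h), coefMat_mul, Matrix.det_mul, det_shiftMat, constantCoeff_inv]
  rfl

lemma aeval_poly_mul (c : MultiIndex d → ℂ) (Z : Fin 4 → ℂ⟦X⟧) (s : ℂ⟦X⟧) :
    MvPolynomial.aeval (fun m => Z m * s) (poly c) = MvPolynomial.aeval Z (poly c) * s ^ d := by
  rw [aeval_poly, aeval_poly, Finset.sum_mul]
  refine Finset.sum_congr rfl fun α _ => ?_
  simp only [mul_pow, Finset.prod_mul_distrib, Finset.prod_pow_eq_pow_sum, α.2, mul_assoc]

lemma change_mem_jets {i j : Fin 4} {q : Ambient d} (h : ratio i j q ≠ 0) (hq : q ∈ jets d i) :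
    change i j q ∈ jets d j := by
  rw [mem_jets_iff] at hq ⊢
  refine ⟨hq.1, ?_⟩
  have : trunc4 (equation j (change i j q)) = trunc4 (equation i q * (base i q j)⁻¹ ^ d) := by
    rw [equation_eq, equation_eq, param_change, map_add, trunc4_aeval (base_change h),
      aeval_poly_mul, map_pow, last_change h, ← map_pow, mul_pow, add_mul, map_add]
  rw [this, map_mul, hq.2, zero_mul]

lemma mem_sigma_of_ratio_ne_zero {i : Fin 4} {q : Ambient d} (hq : q ∈ jets d i)
    (h : ratio i 0 q ≠ 0) (hW : (coefMat (base i q)).det = 0) :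
    q ∈ {q | q ∈ jets d i ∧ ratio i 0 q ≠ 0 ∧ change i 0 q ∈ sigmaZero d} :=
  ⟨hq, h, change_mem_jets h hq, by rw [det_xi_eq, det_coefMat_change h, hW, zero_mul, mul_zero]⟩

/-- The linear substitution `Z₀ ↦ Z₀ - ε Z_i`. -/
noncomputable def shear (i : Fin 4) (ε : ℂ) (m : Fin 4) : MvPolynomial (Fin 4) ℂ :=
  MvPolynomial.X m - if m = 0 then MvPolynomial.C ε * MvPolynomial.X i else 0

lemma isHomogeneous_aeval_shear (i : Fin 4) (ε : ℂ) {P : MvPolynomial (Fin 4) ℂ}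
    (hP : P.IsHomogeneous d) : (MvPolynomial.aeval (shear i ε) P).IsHomogeneous d := by
  have := hP.aeval (shear i ε) (n := 1) fun m => by
    refine (MvPolynomial.isHomogeneous_X _ _).sub ?_
    split_ifs
    · exact MvPolynomial.isHomogeneous_C_mul_X _ _
    · exact MvPolynomial.isHomogeneous_zero _ _ _
  rwa [one_mul] at this

lemma continuous_coeff_aeval_shear (i : Fin 4) (P : MvPolynomial (Fin 4) ℂ) (β : Fin 4 →₀ ℕ) :
    Continuous fun ε => MvPolynomial.coeff β (MvPolynomial.aeval (shear i ε) P) := by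
  classical
  induction P using MvPolynomial.induction_on generalizing β with
  | C a => simpa using continuous_const
  | add P Q hP hQ =>
    simp only [map_add, MvPolynomial.coeff_add]
    exact (hP β).add (hQ β)
  | mul_X P m hP =>
    simp only [map_mul, MvPolynomial.aeval_X, MvPolynomial.coeff_mul]
    refine continuous_finsetSum _ fun a _ => (hP a.1).mul ?_
    simp only [shear, MvPolynomial.coeff_sub]
    refine continuous_const.sub ?_
    split_ifs
    · simp only [MvPolynomial.coeff_C_mul]
      exact continuous_id.mul continuous_const
    · exact continuous_const

/-- The jet `q` moved by `Z₀ ↦ Z₀ + ε Z_i`; here `Z₀ / Z_i` is the `m`-th coordinate function. -/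
noncomputable def perturb (i : Fin 4) (m : Fin 3) (q : Ambient d) (ε : ℂ) : Ambient d :=
  Sum.elim (coeffs d (MvPolynomial.aeval (shear i ε) (poly (param q))))
    fun y => q (Sum.inr y) + if y = Sum.inl (m, 0) then ε else 0

section Perturb

variable {i : Fin 4} {m : Fin 3} (q : Ambient d) (ε : ℂ)

lemma base_perturb (hm : i.succAbove m = 0) (l : Fin 4) :
    base i (perturb i m q ε) l = base i q l + if l = 0 then C ε else 0 := by
  have hx : ∀ n k, xi (perturb i m q ε) n k = xi q n k + if n = m ∧ k = 0 then ε else 0 :=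
    fun n k => by simp [xi, perturb]
  rcases Fin.eq_self_or_eq_succAbove i l with rfl | ⟨n, rfl⟩
  · have : l ≠ 0 := hm ▸ (Fin.succAbove_ne l m).symm
    simp [this]
  · have : i.succAbove n = 0 ↔ n = m := by rw [← hm, Fin.succAbove_right_inj]
    simp only [base, Fin.insertNth_apply_succAbove, hx, this]
    by_cases h : n = m
    · simp [h]
      ring
    · simp [h]

lemma param_perturb : param (perturb i m q ε) =
    coeffs d (MvPolynomial.aeval (shear i ε) (poly (param q))) := rfl

/-- The form is composed with the inverse of the substitution that moves the jet. -/
lemma equation_perturb (hm : i.succAbove m = 0) : equation i (perturb i m q ε) = equation i q := by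
  have h0 : i ≠ 0 := hm ▸ (Fin.succAbove_ne i m).symm
  have hlast : last (perturb i m q ε) = last q := by simp [last, xi4, perturb]
  rw [equation_eq, equation_eq, hlast, param_perturb,
    poly_coeffs (isHomogeneous_aeval_shear i ε (isHomogeneous_poly _)), ← AlgHom.comp_apply,
    MvPolynomial.comp_aeval]
  congr 3
  funext l
  rw [shear, map_sub, MvPolynomial.aeval_X, base_perturb _ _ hm]
  split_ifs
  · rw [aeval_C_mul, MvPolynomial.aeval_X, base_perturb _ _ hm, if_neg h0, base_self]
    ring
  · simp

/-- Moving the jet adds `ε` times row `i` to row 0. -/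
lemma det_coefMat_perturb (hm : i.succAbove m = 0) :
    (coefMat (base i (perturb i m q ε))).det = (coefMat (base i q)).det := by
  have h0 : i ≠ 0 := hm ▸ (Fin.succAbove_ne i m).symm
  rw [← Matrix.det_updateRow_add_smul_self (coefMat (base i q)) h0.symm ε]
  congr 1
  ext l k
  rw [Matrix.updateRow_apply]
  simp only [coefMat, Matrix.of_apply, base_perturb _ _ hm]
  split_ifs with h
  · subst h
    simp [coeff_C, coeff_one]
  · simp

lemma continuous_perturb : Continuous (perturb i m q) := by
  refine continuous_pi fun x => ?_
  rcases x with α | y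
  · exact continuous_coeff_aeval_shear i _ _
  · simp only [perturb, Sum.elim_inr]
    split_ifs <;> fun_prop

lemma perturb_zero : perturb i m q 0 = q := by
  funext x
  rcases x with α | y
  · have : shear i 0 = MvPolynomial.X := by
      funext l
      simp [shear]
    simp only [perturb, Sum.elim_inl, this, MvPolynomial.aeval_X_left_apply, coeffs_poly]
    rfl
  · simp [perturb]

end Perturb

/-- Outside `Σ` the Wronskian does not vanish. -/
lemma det_coefMat_ne_zero {i : Fin 4} {q : Ambient d} (hq : q ∈ jets d i)
    (hS : q ∉ sigma d i) : (coefMat (base i q)).det ≠ 0 := by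
  intro hW
  apply hS
  by_cases h : ratio i 0 q = 0
  swap
  · exact subset_closure (mem_sigma_of_ratio_ne_zero hq h hW)
  have hi : (0 : Fin 4) ≠ i := by
    rintro rfl
    simp [ratio] at h
  obtain ⟨m, hm⟩ := Fin.exists_succAbove_eq hi
  have hcont := (continuous_perturb (i := i) (m := m) q).tendsto 0
  rw [perturb_zero] at hcont
  -- A degenerate jet over `Z_0 = 0` is a limit of degenerate jets with `Z_0 / Z_i = ε ≠ 0`, so it
  -- lies in the closure.
  refine mem_closure_of_tendsto (hcont.mono_left (nhdsWithin_le_nhds (s := {(0 : ℂ)}ᶜ))) ?_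
  rw [mem_jets_iff] at hq
  obtain ⟨⟨α, hα⟩, heq⟩ := hq
  have hparam : ∀ᶠ p in nhds q, param p α ≠ 0 :=
    (continuous_apply (Sum.inl α)).continuousAt.eventually_ne hα
  filter_upwards [(hcont.eventually hparam).filter_mono nhdsWithin_le_nhds, self_mem_nhdsWithin]
    with ε h1 h2
  refine mem_sigma_of_ratio_ne_zero (mem_jets_iff.2 ⟨⟨α, h1⟩, ?_⟩) ?_ ?_
  · rw [equation_perturb _ _ hm, heq]
  · rw [ratio, base_perturb _ _ hm, map_add]
    change ratio i 0 q + _ ≠ 0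
    rw [h]
    simpa using h2
  · rw [det_coefMat_perturb _ _ hm, hW]

end LogJet

theorem proposition3 (d : ℕ) (hd : 1 ≤ d) (i : Fin 4) (q : LogJet.Ambient d)
    (hq : q ∈ LogJet.jets d i) (hS : q ∉ LogJet.sigma d i) (hH : q ∉ LogJet.overH d) :
    Submodule.span ℂ (Set.range fun s : LogJet.TwistedField d 12 => s.value i q) =
      LogJet.tangent i q := by
  refine le_antisymm (Submodule.span_le.2 ?_)
    (LogJet.tangent_le_span hd hq (LogJet.det_coefMat_ne_zero hq hS) hH)
  rintro _ ⟨s, rfl⟩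
  exact s.tangent_mem i q hq
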